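/- **Setting.** Let $\mathbb K$ be the ordered field of absolutely convergent generalized real Puiseux series: formal series $\boldsymbol x=\sum_{\alpha\in\mathbb R}c_\alpha t^\alpha$ with real coefficients, whose support $\{\alpha : c_\alpha\neq 0\}$ is finite or has $-\infty$ as its only accumulation point, and which converge absolutely for all sufficiently large real $t$; $\boldsymbol x(t)$ denotes the value. A nonzero series is positive if the coefficient of its term of greatest exponent is positive. The valuation $\operatorname{val}\boldsymbol x\in\mathbb T:=\mathbb R\cup\{-\infty\}$ is the greatest exponent in the support, with $\operatorname{val}0=-\infty$; it is applied entrywise to vectors. The set $\mathbb T$ carries its order topology, and $\mathbb T^n$ the product topology and the entrywise order. A tropical polyhedron is a set of points $x\in\mathbb T^n$ defined by finitely many inequalities $\max(\alpha_0,\max_i(\alpha_i+x_i))\le\max(\beta_0,\max_i(\beta_i+x_i))$ with $\alpha_i,\beta_i\in\mathbb T$; a tropical polytope is a compact tropical polyhedron, and its tropical barycenter is its greatest element. For $\boldsymbol A\in\mathbb K^{m\times n}$ and $\boldsymbol b\in\mathbb K^m$ let $\boldsymbol P=\{\boldsymbol x\in\mathbb K^n : \boldsymbol A\boldsymbol x\le\boldsymbol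 b\}$ and, for large real $t$, $\boldsymbol P(t)=\{x\in\mathbb R^n : \boldsymbol A(t)x\le\boldsymbol b(t)\}$. For a polyhedron $P\subset\mathbb R^n$ with nonempty interior let $f_P(\theta)=\log\int_P e^{\langle\theta,x\rangle}\,dx\in\mathbb R\cup\{+\infty\}$ and let $f_P^*(x)=\sup_{\theta\in\mathbb R^n}(\langle\theta,x\rangle-f_P(\theta))$ be the entropic barrier of $P$. For $c\in\mathbb R^n$ and $\mu>0$, the point $\mathcal C_{P,c}(\mu)$ of the entropic central path is the unique minimizer of $x\mapsto\langle c,x\rangle+\mu f_P^*(x)$ over the interior of $P$. **Theorem.** Let $\boldsymbol P=\{\boldsymbol x\in\mathbb K^n : \boldsymbol A\boldsymbol x\le\boldsymbol b\}$ and $\boldsymbol c\in\mathbb K^n$ be such that 1. $\boldsymbol P\subset\mathbb K_{\ge 0}^n$ and $0\in\boldsymbol P$; 2. $\operatorname{val}\boldsymbol P\subset\mathbb T^n$ is equal to the closure of its interior; 3. $\boldsymbol c_i>0$ for all $i$. Let $\boldsymbol\mu\in\mathbb K$ with $\boldsymbol\mu>0$. Then the set $$S=\{x\in\operatorname{val}\boldsymbol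 P : \max_i(\operatorname{val}\boldsymbol c_i+x_i)\le\operatorname{val}\boldsymbol\mu\}$$ is a tropical polytope, the minimizer $\mathcal C_{\boldsymbol P(t),\boldsymbol c(t)}(\boldsymbol\mu(t))$ exists and is unique for all sufficiently large $t$, and the entrywise limit $$\lim_{t\to+\infty}\log_t\,\mathcal C_{\boldsymbol P(t),\boldsymbol c(t)}(\boldsymbol\mu(t)),\qquad \log_t(\cdot)=\frac{\log(\cdot)}{\log t},$$ exists in $\mathbb R^n$ and is equal to the tropical barycenter of $S$. -/

import Mathlib

open Filter Topology MeasureTheory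

noncomputable section

namespace TropicalEntropic

/-! ### Absolutely convergent generalized real Puiseux series -/

/-- Formal series `∑ c_α t^α` with real exponents and real coefficients whose support is well
ordered for the *decreasing* order of the exponents (hence the index `ℝᵒᵈ`). `Lex` carries the
order in which a nonzero series is positive iff the coefficient of its term of greatest exponent
is positive. -/
abbrev RealHahn : Type := Lex (HahnSeries ℝᵒᵈ ℝ)

/-- The coefficient of `t^α`. -/
def coeffAt (x : RealHahn) (α : ℝ) : ℝ := (ofLex x).coeff (OrderDual.toDual α)

/-- The support is finite or accumulates at `-∞` only (i.e. it has finitely many elements above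
every real number), and the series converges absolutely for all sufficiently large real `t`. -/
def IsConvergentPuiseux (x : RealHahn) : Prop :=
  (∀ a : ℝ, {α : ℝ | a ≤ α ∧ coeffAt x α ≠ 0}.Finite) ∧
    ∀ᶠ t : ℝ in atTop, Summable fun α : ℝ => |coeffAt x α * t ^ α|

theorem coeffAt_zero (α : ℝ) : coeffAt 0 α = 0 := rfl

theorem coeffAt_add (x y : RealHahn) (α : ℝ) :
    coeffAt (x + y) α = coeffAt x α + coeffAt y α := rfl

theorem coeffAt_neg (x : RealHahn) (α : ℝ) : coeffAt (-x) α = -coeffAt x α := rfl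

theorem coeffAt_one (α : ℝ) : coeffAt 1 α = if α = 0 then 1 else 0 := by
  unfold coeffAt
  rw [ofLex_one, HahnSeries.coeff_one]
  rfl

theorem IsConvergentPuiseux.zero : IsConvergentPuiseux 0 := by
  constructor
  · intro a; simp [coeffAt_zero]
  · simp [coeffAt_zero, summable_zero]

theorem IsConvergentPuiseux.one : IsConvergentPuiseux 1 := by
  constructor
  · intro a
    refine (Set.finite_singleton (0 : ℝ)).subset ?_
    rintro α ⟨-, h⟩
    by_contra h0
    exact h (by rw [coeffAt_one, if_neg (by simpa using h0)])
  · refine Eventually.of_forall fun t => ?_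
    refine summable_of_ne_finset_zero (s := {0}) fun α hα => ?_
    rw [coeffAt_one, if_neg (by simpa using hα)]
    simp

theorem IsConvergentPuiseux.neg {x : RealHahn} (hx : IsConvergentPuiseux x) :
    IsConvergentPuiseux (-x) := by
  simpa [IsConvergentPuiseux, coeffAt_neg] using hx

theorem IsConvergentPuiseux.add {x y : RealHahn} (hx : IsConvergentPuiseux x)
    (hy : IsConvergentPuiseux y) : IsConvergentPuiseux (x + y) := by
  constructor
  · intro a
    refine ((hx.1 a).union (hy.1 a)).subset ?_
    rintro α ⟨ha, h⟩
    rw [coeffAt_add] at h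
    by_cases h0 : coeffAt x α = 0
    · right; exact ⟨ha, by simpa [h0] using h⟩
    · left; exact ⟨ha, h0⟩
  · filter_upwards [hx.2, hy.2] with t h1 h2
    refine Summable.of_nonneg_of_le (fun _ => abs_nonneg _) (fun α => ?_) (h1.add h2)
    rw [coeffAt_add, add_mul]
    exact abs_add_le _ _

theorem IsConvergentPuiseux.exists_bound {x : RealHahn} (hx : IsConvergentPuiseux x) :
    ∃ B : ℝ, ∀ α, coeffAt x α ≠ 0 → α ≤ B := by
  obtain ⟨B, hB⟩ := (hx.1 0).bddAbove
  refine ⟨max B 0, fun α hα => ?_⟩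
  rcases le_total 0 α with h | h
  · exact le_max_of_le_left (hB ⟨h, hα⟩)
  · exact le_max_of_le_right h

theorem IsConvergentPuiseux.mul {x y : RealHahn} (hx : IsConvergentPuiseux x)
    (hy : IsConvergentPuiseux y) : IsConvergentPuiseux (x * y) := by
  constructor
  · intro a
    obtain ⟨B, hB⟩ := hx.exists_bound
    obtain ⟨C, hC⟩ := hy.exists_bound
    refine (((hx.1 (a - C)).prod (hy.1 (a - B))).image fun p => p.1 + p.2).subset ?_
    rintro γ ⟨ha, h⟩
    have h' : OrderDual.toDual γ ∈ (ofLex x * ofLex y).support := h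
    obtain ⟨α, hα, β, hβ, hαβ⟩ := Set.mem_add.1 (HahnSeries.support_mul_subset h')
    have hγ : OrderDual.ofDual α + OrderDual.ofDual β = γ := congrArg OrderDual.ofDual hαβ
    have h1 : coeffAt x (OrderDual.ofDual α) ≠ 0 := hα
    have h2 : coeffAt y (OrderDual.ofDual β) ≠ 0 := hβ
    have h3 := hB _ h1
    have h4 := hC _ h2
    exact ⟨(OrderDual.ofDual α, OrderDual.ofDual β),
      ⟨⟨by linarith, h1⟩, ⟨by linarith, h2⟩⟩, hγ⟩
  · filter_upwards [hx.2, hy.2, eventually_gt_atTop 0] with t h1 h2 ht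
    have hs : Summable fun p : ℝ × ℝ =>
        |coeffAt x p.1 * t ^ p.1| * |coeffAt y p.2 * t ^ p.2| :=
      h1.mul_of_nonneg h2 (fun _ => abs_nonneg _) (fun _ => abs_nonneg _)
    let e : ℝ × ℝ ≃ ℝ × ℝ :=
      { toFun := fun p => (p.2, p.1 - p.2)
        invFun := fun q => (q.1 + q.2, q.1)
        left_inv := fun p => by simp
        right_inv := fun q => by simp }
    have hs' : Summable fun p : ℝ × ℝ =>
        |coeffAt x p.2 * t ^ p.2| * |coeffAt y (p.1 - p.2) * t ^ (p.1 - p.2)| :=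
      (e.summable_iff).2 hs
    have hnn : (0 : ℝ × ℝ → ℝ) ≤ fun p : ℝ × ℝ =>
        |coeffAt x p.2 * t ^ p.2| * |coeffAt y (p.1 - p.2) * t ^ (p.1 - p.2)| :=
      fun p => mul_nonneg (abs_nonneg _) (abs_nonneg _)
    obtain ⟨hf, ht'⟩ := (summable_prod_of_nonneg hnn).1 hs'
    refine Summable.of_nonneg_of_le (fun _ => abs_nonneg _) (fun γ => ?_) ht'
    have hcoeff : coeffAt (x * y) γ = (ofLex x * ofLex y).coeff (OrderDual.toDual γ) := rfl
    rw [hcoeff, HahnSeries.coeff_mul, Finset.sum_mul]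
    refine (Finset.abs_sum_le_sum_abs _ _).trans ?_
    have hmem : ∀ p ∈ Finset.antidiagonal (ofLex x).isPWO_support (ofLex y).isPWO_support
        (OrderDual.toDual γ), OrderDual.ofDual p.2 = γ - OrderDual.ofDual p.1 := by
      intro p hp
      have hp' : OrderDual.ofDual p.1 + OrderDual.ofDual p.2 = γ :=
        congrArg OrderDual.ofDual (Finset.mem_antidiagonal.1 hp).2.2
      linarith
    have hterm : ∀ p ∈ Finset.antidiagonal (ofLex x).isPWO_support (ofLex y).isPWO_support
        (OrderDual.toDual γ),
        |(ofLex x).coeff p.1 * (ofLex y).coeff p.2 * t ^ γ| =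
          (fun α : ℝ => |coeffAt x α * t ^ α| * |coeffAt y (γ - α) * t ^ (γ - α)|)
            (OrderDual.ofDual p.1) := by
      intro p hp
      have h2 := hmem p hp
      have hx1 : (ofLex x).coeff p.1 = coeffAt x (OrderDual.ofDual p.1) := rfl
      have hy1 : (ofLex y).coeff p.2 = coeffAt y (OrderDual.ofDual p.2) := rfl
      have hpow : t ^ γ = t ^ (OrderDual.ofDual p.1) * t ^ (γ - OrderDual.ofDual p.1) := by
        rw [← Real.rpow_add ht]; congr 1; ring
      simp only [← abs_mul]
      rw [hx1, hy1, h2, hpow]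
      congr 1
      ring
    rw [Finset.sum_congr rfl hterm]
    rw [← Finset.sum_image (f := fun α : ℝ =>
      |coeffAt x α * t ^ α| * |coeffAt y (γ - α) * t ^ (γ - α)|)
      (g := fun p : ℝᵒᵈ × ℝᵒᵈ => OrderDual.ofDual p.1)]
    · exact (hf γ).sum_le_tsum _ fun _ _ => mul_nonneg (abs_nonneg _) (abs_nonneg _)
    · intro p hp q hq hpq
      have h1 := hmem p hp
      have h2 := hmem q hq
      have hpq' : OrderDual.ofDual p.1 = OrderDual.ofDual q.1 := hpq
      refine Prod.ext (OrderDual.ofDual.injective hpq') (OrderDual.ofDual.injective ?_)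
      rw [h1, h2, hpq']

/-- Absolutely convergent generalized real Puiseux series, with the ring operations of formal
series and the order given by the sign of the leading coefficient. -/
def puiseuxSubring : Subring RealHahn where
  carrier := {x | IsConvergentPuiseux x}
  mul_mem' := IsConvergentPuiseux.mul
  one_mem' := IsConvergentPuiseux.one
  add_mem' := IsConvergentPuiseux.add
  zero_mem' := IsConvergentPuiseux.zero
  neg_mem' := IsConvergentPuiseux.neg

/-- The ordered field `𝕂` of absolutely convergent generalized real Puiseux series. -/
abbrev Puiseux : Type := puiseuxSubring

/-- The value `x(t)` of the series at a real number `t` (meaningful for all large `t`). -/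
def Puiseux.eval (x : Puiseux) (t : ℝ) : ℝ := ∑' α : ℝ, coeffAt x.1 α * t ^ α

/-- The max-plus semifield `𝕋 = ℝ ∪ {-∞}` with its order topology; `+` of `WithBot` is the
tropical product and `⊔` the tropical sum. -/
abbrev Trop : Type := WithBot ℝ

/-- The greatest exponent in the support of a series, `-∞` for the zero series. -/
def Puiseux.val (x : Puiseux) : Trop := WithTop.ofDual (ofLex x.1).orderTop

/-! ### Polyhedra over Puiseux series -/

/-- `{x ∈ 𝕂ⁿ : A x ≤ b}`. -/
def polyhedron {m n : ℕ} (A : Matrix (Fin m) (Fin n) Puiseux) (b : Fin m → Puiseux) :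
    Set (Fin n → Puiseux) :=
  {x | ∀ i, ∑ j, A i j * x j ≤ b i}

/-- `{x ∈ ℝⁿ : A(t) x ≤ b(t)}`. -/
def polyhedronAt {m n : ℕ} (A : Matrix (Fin m) (Fin n) Puiseux) (b : Fin m → Puiseux) (t : ℝ) :
    Set (Fin n → ℝ) :=
  {x | ∀ i, ∑ j, (A i j).eval t * x j ≤ (b i).eval t}

/-- The image of a subset of `𝕂ⁿ` under the entrywise valuation. -/
def valImage {n : ℕ} (P : Set (Fin n → Puiseux)) : Set (Fin n → Trop) :=
  (fun x i => (x i).val) '' P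

/-! ### Tropical polyhedra -/

/-- The tropical scalar product `max_i (x_i + y_i)`, equal to `-∞` if `n = 0`. -/
def tropDot {n : ℕ} (x y : Fin n → Trop) : Trop := Finset.univ.sup fun i => x i + y i

/-- Solution sets of finitely many tropical affine inequalities. -/
def IsTropicalPolyhedron {n : ℕ} (S : Set (Fin n → Trop)) : Prop :=
  ∃ (k : ℕ) (α₀ β₀ : Fin k → Trop) (α β : Fin k → Fin n → Trop),
    S = {x | ∀ j, α₀ j ⊔ tropDot (α j) x ≤ β₀ j ⊔ tropDot (β j) x}

/-- Compact tropical polyhedra. -/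
def IsTropicalPolytope {n : ℕ} (S : Set (Fin n → Trop)) : Prop :=
  IsTropicalPolyhedron S ∧ IsCompact S

/-- `x` is the tropical barycenter of `S`: its greatest element for the entrywise order. -/
def IsTropicalBarycenter {n : ℕ} (S : Set (Fin n → Trop)) (x : Fin n → Trop) : Prop :=
  IsGreatest S x

/-! ### The entropic central path -/

/-- `f_K(θ) = log ∫_K exp ⟨θ, x⟩ dx`, with value `+∞` where the integral diverges. -/
def logLaplace {n : ℕ} (K : Set (Fin n → ℝ)) (θ : Fin n → ℝ) : EReal :=
  ENNReal.log (∫⁻ x in K, ENNReal.ofReal (Real.exp (∑ i, θ i * x i)))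

/-- The entropic barrier `f_K^*`: the Fenchel conjugate of `f_K`. -/
def entropicBarrier {n : ℕ} (K : Set (Fin n → ℝ)) (x : Fin n → ℝ) : EReal :=
  ⨆ θ : Fin n → ℝ, ((∑ i, θ i * x i : ℝ) : EReal) - logLaplace K θ

/-- The objective function `x ↦ ⟨c, x⟩ + μ f_K^*(x)`. -/
def penalizedCost {n : ℕ} (K : Set (Fin n → ℝ)) (c : Fin n → ℝ) (μ : ℝ) (x : Fin n → ℝ) : EReal :=
  ((∑ i, c i * x i : ℝ) : EReal) + (μ : EReal) * entropicBarrier K x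

/-- `x` minimizes `⟨c, x⟩ + μ f_K^*(x)` over the interior of `K`. -/
def IsEntropicCentralPoint {n : ℕ} (K : Set (Fin n → ℝ)) (c : Fin n → ℝ) (μ : ℝ)
    (x : Fin n → ℝ) : Prop :=
  x ∈ interior K ∧ IsMinOn (penalizedCost K c μ) (interior K) x

/-- The point `𝒞_{K,c}(μ)` of the entropic central path: the minimizer of `⟨c, x⟩ + μ f_K^*(x)`
over the interior of `K` (arbitrary if there is none). -/
def entropicCentralPath {n : ℕ} (K : Set (Fin n → ℝ)) (c : Fin n → ℝ) (μ : ℝ) : Fin n → ℝ :=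
  Classical.epsilon (IsEntropicCentralPoint K c μ)

end TropicalEntropic

end

open TropicalEntropic

noncomputable section

namespace TropicalEntropic

/-! ### Leading terms and valuations -/

namespace Puiseux

/-! The gradient of the log-Laplace transform of `P(t)` at `-w` is the mean of the probability
density proportional to `exp (-⟨w, x⟩)` on `P(t)`. Fenchel duality therefore identifies the central
point with this mean for `w = c(t) / μ(t)` (`isEntropicCentralPoint_iff`), and the theorem becomes a
statement about the order of magnitude of the mean.

Let `x*` be the greatest point of `S`. Two facts pin the mean down. First, if `x ∈ P(t)`, then `x /
(1 + ⟨w, x⟩)` lies in the section of `P(t)` of cost at most `μ(t)`, because `0 ∈ P`. That section is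
bounded by `t^(x* + ε)`, so large coordinates force a small density (`eventually_le_mul_one_add`).
Second, regularity provides a real interior point `y` of `val P` close to `x*`, and `P(t)` contains
the whole box from `t^(y - ε)` to `2 t^(y - ε)`, on which the density is at least `exp (-1)`
(`eventually_box_subset_polyhedronAt`). Comparing integrals bounds the mean on both sides by `t^(x*
± O(ε))`, up to a constant depending on `n` only (`exists_expMean_bounds`).

Inequalities pass between `𝕂` and large real `t` by the double description method. It yields
finitely many vectors over `𝕂`, in the homogenized cone, whose values control in the dual sense the
cone over `P(t)` for all large `t` (`exists_polyhedron_generators`). A linear inequality then needs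
checking only on these generators. The same generators show that `val P` is a tropical polyhedron:
their valuations generate its homogenization, which residuation describes by finitely many
inequalities (`isTropicalPolyhedron_valImage`). -/

theorem val_eq_bot_iff {x : Puiseux} : x.val = ⊥ ↔ x = 0 := by
  rw [Subtype.ext_iff]
  change WithTop.ofDual (ofLex x.1).orderTop = ⊥ ↔ ofLex x.1 = 0
  rw [← HahnSeries.orderTop_eq_top]
  exact Iff.rfl

@[simp] theorem val_zero : (0 : Puiseux).val = ⊥ := val_eq_bot_iff.2 rfl

theorem orderTop_of_val {x : Puiseux} {v : ℝ} (h : x.val = v) :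
    (ofLex x.1).orderTop = (OrderDual.toDual v : ℝᵒᵈ) := h

theorem coeffAt_val_ne {x : Puiseux} {v : ℝ} (h : x.val = v) : coeffAt x.1 v ≠ 0 :=
  HahnSeries.coeff_orderTop_ne (orderTop_of_val h)

theorem coeffAt_eq_zero_of_val_lt {x : Puiseux} {α : ℝ} (h : x.val < α) : coeffAt x.1 α = 0 := by
  refine HahnSeries.coeff_eq_zero_of_lt_orderTop (x := ofLex x.1) ?_
  exact h

theorem val_le_iff {x : Puiseux} {v : ℝ} : x.val ≤ v ↔ ∀ α, v < α → coeffAt x.1 α = 0 := by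
  refine ⟨fun h α hα => coeffAt_eq_zero_of_val_lt (h.trans_lt (by exact_mod_cast hα)), fun h => ?_⟩
  by_contra hlt
  rw [not_le] at hlt
  obtain ⟨w, hx⟩ := WithBot.ne_bot_iff_exists.1 hlt.ne_bot
  rw [← hx] at hlt
  exact coeffAt_val_ne hx.symm (h w (by exact_mod_cast hlt))

theorem pos_of_coeffAt {x : Puiseux} {v : ℝ} (h : 0 < coeffAt x.1 v)
    (h' : ∀ α, v < α → coeffAt x.1 α = 0) : 0 < x := by
  change (0 : RealHahn) < x.1
  rw [HahnSeries.lt_iff]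
  exact ⟨OrderDual.toDual v, fun j hj => (h' (OrderDual.ofDual j) hj).symm, h⟩

theorem coeffAt_val_pos {x : Puiseux} (hx : 0 < x) {v : ℝ} (h : x.val = v) :
    0 < coeffAt x.1 v := by
  by_contra hn
  have hneg : 0 < -x := by
    refine pos_of_coeffAt (v := v) ?_ fun α hα => ?_
    · change 0 < coeffAt (-x.1) v
      rw [coeffAt_neg]
      have := lt_of_le_of_ne (not_lt.1 hn) (coeffAt_val_ne h)
      linarith
    · change coeffAt (-x.1) α = 0
      rw [coeffAt_neg, val_le_iff.1 h.le α hα, neg_zero]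
  exact lt_asymm hx (neg_pos.1 hneg)

theorem exists_val_eq {x : Puiseux} (hx : x ≠ 0) : ∃ v : ℝ, x.val = v := by
  obtain ⟨v, hv⟩ := WithBot.ne_bot_iff_exists.1 (mt val_eq_bot_iff.1 hx)
  exact ⟨v, hv.symm⟩

theorem coeffAt_sub (x y : Puiseux) (α : ℝ) :
    coeffAt (x - y).1 α = coeffAt x.1 α - coeffAt y.1 α := rfl

/-- The leading term of `q - p` is that of `q`, whatever the sign of `p`. -/
theorem lt_of_val_lt {p q : Puiseux} (hq : 0 < q) (h : p.val < q.val) : p < q := by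
  obtain ⟨v, hv⟩ := exists_val_eq hq.ne'
  rw [hv] at h
  rw [← sub_pos]
  refine pos_of_coeffAt (v := v) ?_ fun α hα => ?_
  · rw [coeffAt_sub, coeffAt_eq_zero_of_val_lt h, sub_zero]
    exact coeffAt_val_pos hq hv
  · rw [coeffAt_sub, val_le_iff.1 hv.le α hα, val_le_iff.1 h.le α hα, sub_zero]

theorem val_mono {p q : Puiseux} (hp : 0 ≤ p) (h : p ≤ q) : p.val ≤ q.val := by
  by_contra hlt
  rw [not_le] at hlt
  have hp0 : p ≠ 0 := fun h0 => by
    rw [h0, val_zero] at hlt; exact not_lt_bot hlt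
  exact (lt_of_val_lt (lt_of_le_of_ne hp hp0.symm) hlt).not_ge h

theorem val_mul (x y : Puiseux) : (x * y).val = x.val + y.val := by
  have h : (ofLex x.1 * ofLex y.1).orderTop = _ := HahnSeries.orderTop_mul (ofLex x.1) (ofLex y.1)
  change WithTop.ofDual (ofLex x.1 * ofLex y.1).orderTop = _
  rw [h]
  rfl

theorem val_add_le (x y : Puiseux) : (x + y).val ≤ x.val ⊔ y.val :=
  HahnSeries.min_orderTop_le_orderTop_add (x := ofLex x.1) (y := ofLex y.1)

/-- Leading terms of nonnegative series cannot cancel: each summand is at most the sum, and the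
valuation is monotone on nonnegative series. -/
theorem val_sum_of_nonneg {ι : Type*} (s : Finset ι) (f : ι → Puiseux)
    (hf : ∀ i ∈ s, 0 ≤ f i) : (∑ i ∈ s, f i).val = s.sup fun i => (f i).val := by
  apply le_antisymm
  · clear hf
    classical
    induction s using Finset.induction_on with
    | empty => simp
    | insert a s ha ih =>
      rw [Finset.sum_insert ha, Finset.sup_insert]
      exact (val_add_le _ _).trans (sup_le_sup_left ih _)
  · exact Finset.sup_le fun i hi =>
      val_mono (hf i hi) (Finset.single_le_sum (f := f) hf hi)

/-! ### Monomials -/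

theorem coeffAt_single (r a α : ℝ) :
    coeffAt (toLex (HahnSeries.single (OrderDual.toDual a) r)) α = if α = a then r else 0 := by
  unfold coeffAt
  rw [ofLex_toLex, HahnSeries.coeff_single]
  rfl

theorem isConvergentPuiseux_single (r a : ℝ) :
    IsConvergentPuiseux (toLex (HahnSeries.single (OrderDual.toDual a) r)) := by
  constructor
  · intro a'
    refine (Set.finite_singleton a).subset ?_
    rintro α ⟨-, h⟩
    by_contra h0
    exact h (by rw [coeffAt_single, if_neg (by simpa using h0)])
  · refine Eventually.of_forall fun t => ?_
    refine summable_of_ne_finset_zero (s := {a}) fun α hα => ?_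
    rw [coeffAt_single, if_neg (by simpa using hα)]
    simp

/-- The series `r t^a`. -/
def monomial (r a : ℝ) : Puiseux :=
  ⟨toLex (HahnSeries.single (OrderDual.toDual a) r), isConvergentPuiseux_single r a⟩

theorem coeffAt_monomial (r a α : ℝ) : coeffAt (monomial r a).1 α = if α = a then r else 0 :=
  coeffAt_single r a α

theorem val_monomial {r : ℝ} (hr : r ≠ 0) (a : ℝ) : (monomial r a).val = a := by
  change WithTop.ofDual (HahnSeries.single (OrderDual.toDual a) r).orderTop = _
  rw [HahnSeries.orderTop_single hr]
  rfl

theorem monomial_pos {r : ℝ} (hr : 0 < r) (a : ℝ) : 0 < monomial r a := by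
  refine pos_of_coeffAt (v := a) ?_ fun α hα => ?_
  · rwa [coeffAt_monomial, if_pos rfl]
  · rw [coeffAt_monomial, if_neg hα.ne']

theorem monomial_mul (r a s b : ℝ) :
    monomial r a * monomial s b = monomial (r * s) (a + b) := by
  apply Subtype.ext
  change ofLex _ * ofLex _ = HahnSeries.single _ _
  exact HahnSeries.single_mul_single

theorem monomial_add (r s a : ℝ) : monomial r a + monomial s a = monomial (r + s) a := by
  apply Subtype.ext
  exact (HahnSeries.single_add (OrderDual.toDual a) r s).symm

theorem monomial_one_zero : monomial 1 0 = 1 := rfl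

theorem eval_monomial (r a t : ℝ) : (monomial r a).eval t = r * t ^ a := by
  unfold eval
  rw [tsum_eq_single a fun α hα => by rw [coeffAt_monomial, if_neg hα, zero_mul],
    coeffAt_monomial, if_pos rfl]

/-- A series is at most a real multiple of any positive series of the same valuation. -/
theorem exists_le_monomial_mul {p q : Puiseux} (hq : 0 < q) (h : p.val ≤ q.val) :
    ∃ r : ℝ, 0 < r ∧ p ≤ monomial r 0 * q := by
  obtain ⟨v, hv⟩ := exists_val_eq hq.ne'
  rw [hv] at h
  have hq' := coeffAt_val_pos hq hv
  set r : ℝ := (|coeffAt p.1 v| + 1) / coeffAt q.1 v with hr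
  have hr0 : 0 < r := by positivity
  have hmul : ∀ α, coeffAt (monomial r 0 * q).1 α = r * coeffAt q.1 α := by
    intro α
    change (HahnSeries.single (0 : ℝᵒᵈ) r * ofLex q.1).coeff (OrderDual.toDual α) = _
    rw [HahnSeries.coeff_single_zero_mul]
    rfl
  refine ⟨r, hr0, (sub_pos.1 (pos_of_coeffAt (v := v) ?_ fun α hα => ?_)).le⟩
  · rw [coeffAt_sub, hmul, hr, div_mul_cancel₀ _ hq'.ne']
    linarith [le_abs_self (coeffAt p.1 v)]
  · rw [coeffAt_sub, hmul, val_le_iff.1 hv.le α hα, val_le_iff.1 h α hα]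
    ring

/-! ### Evaluation -/

theorem eventually_summable (x : Puiseux) :
    ∀ᶠ t : ℝ in atTop, Summable fun α : ℝ => coeffAt x.1 α * t ^ α :=
  x.2.2.mono fun _ h => h.of_abs

theorem eval_zero (t : ℝ) : (0 : Puiseux).eval t = 0 := by
  unfold eval
  refine (tsum_congr fun α => ?_).trans tsum_zero
  change coeffAt 0 α * _ = 0
  rw [coeffAt_zero, zero_mul]

theorem eval_neg (x : Puiseux) (t : ℝ) : (-x).eval t = -x.eval t := by
  unfold eval
  rw [← tsum_neg]
  refine tsum_congr fun α => ?_
  change coeffAt (-x.1) α * _ = _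
  rw [coeffAt_neg, neg_mul]

theorem eval_one (t : ℝ) : (1 : Puiseux).eval t = 1 := by
  rw [← monomial_one_zero, eval_monomial]
  simp

theorem eventually_eval_add (x y : Puiseux) :
    ∀ᶠ t : ℝ in atTop, (x + y).eval t = x.eval t + y.eval t := by
  filter_upwards [x.eventually_summable, y.eventually_summable] with t hx hy
  unfold eval
  rw [← hx.tsum_add hy]
  refine tsum_congr fun α => ?_
  change coeffAt (x.1 + y.1) α * _ = _
  rw [coeffAt_add, add_mul]

theorem eventually_eval_sub (x y : Puiseux) :
    ∀ᶠ t : ℝ in atTop, (x - y).eval t = x.eval t - y.eval t := by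
  filter_upwards [eventually_eval_add x (-y)] with t h
  rw [sub_eq_add_neg, h, eval_neg, sub_eq_add_neg]

/-- Writes the finite antidiagonal sum as an unrestricted convolution, the form produced by
reindexing the product of two absolutely convergent series. -/
theorem coeffAt_mul_eq_tsum (x y : Puiseux) (γ : ℝ) :
    coeffAt (x * y).1 γ = ∑' α : ℝ, coeffAt x.1 α * coeffAt y.1 (γ - α) := by
  classical
  change (ofLex x.1 * ofLex y.1).coeff (OrderDual.toDual γ) = _
  rw [HahnSeries.coeff_mul]
  set D := Finset.antidiagonal (ofLex x.1).isPWO_support (ofLex y.1).isPWO_support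
        (OrderDual.toDual γ) with hD
  have hmem : ∀ p ∈ D, OrderDual.ofDual p.2 = γ - OrderDual.ofDual p.1 := by
    intro p hp
    have hp' : OrderDual.ofDual p.1 + OrderDual.ofDual p.2 = γ :=
      congrArg OrderDual.ofDual (Finset.mem_antidiagonal.1 hp).2.2
    linarith
  rw [tsum_eq_sum (s := D.image fun p => OrderDual.ofDual p.1)]
  · rw [Finset.sum_image]
    · refine Finset.sum_congr rfl fun p hp => ?_
      rw [← hmem p hp]
      rfl
    · intro p hp q hq hpq
      have hpq' : OrderDual.ofDual p.1 = OrderDual.ofDual q.1 := hpq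
      refine Prod.ext (OrderDual.ofDual.injective hpq') (OrderDual.ofDual.injective ?_)
      rw [hmem p hp, hmem q hq, hpq']
  · intro α hα
    by_contra h0
    refine hα (Finset.mem_image.2 ⟨(OrderDual.toDual α, OrderDual.toDual (γ - α)), ?_, rfl⟩)
    refine Finset.mem_antidiagonal.2 ⟨left_ne_zero_of_mul h0, right_ne_zero_of_mul h0, ?_⟩
    change OrderDual.toDual (α + (γ - α)) = _
    congr 1
    ring

theorem eventually_eval_mul (x y : Puiseux) :
    ∀ᶠ t : ℝ in atTop, (x * y).eval t = x.eval t * y.eval t := by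
  filter_upwards [x.2.2, y.2.2, eventually_gt_atTop 0] with t hx hy ht
  have hs := summable_mul_of_summable_norm (f := fun α : ℝ => coeffAt x.1 α * t ^ α)
    (g := fun α : ℝ => coeffAt y.1 α * t ^ α) hx hy
  let e : ℝ × ℝ ≃ ℝ × ℝ :=
    { toFun := fun p => (p.2, p.1 - p.2)
      invFun := fun q => (q.1 + q.2, q.1)
      left_inv := fun p => by simp
      right_inv := fun q => by simp }
  unfold eval
  rw [tsum_mul_tsum_of_summable_norm (f := fun α : ℝ => coeffAt x.1 α * t ^ α)
    (g := fun α : ℝ => coeffAt y.1 α * t ^ α) hx hy, ← e.tsum_eq]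
  refine Eq.trans ?_ (Summable.tsum_prod ((e.summable_iff).2 hs)).symm
  refine tsum_congr fun γ => ?_
  rw [coeffAt_mul_eq_tsum, ← tsum_mul_right]
  refine tsum_congr fun α => ?_
  change _ = coeffAt x.1 α * t ^ α * (coeffAt y.1 (γ - α) * t ^ (γ - α))
  have hpow : t ^ γ = t ^ α * t ^ (γ - α) := by
    rw [← Real.rpow_add ht]; congr 1; ring
  rw [hpow]
  ring

theorem eventually_eval_sum {ι : Type*} (s : Finset ι) (f : ι → Puiseux) :
    ∀ᶠ t : ℝ in atTop, (∑ i ∈ s, f i).eval t = ∑ i ∈ s, (f i).eval t := by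
  classical
  induction s using Finset.induction_on with
  | empty => simp [eval_zero]
  | insert a s ha ih =>
    filter_upwards [ih, eventually_eval_add (f a) (∑ i ∈ s, f i)] with t h1 h2
    rw [Finset.sum_insert ha, Finset.sum_insert ha, h2, h1]

theorem eventually_eval_dot {ι : Type*} [Fintype ι] (f g : ι → Puiseux) :
    ∀ᶠ t : ℝ in atTop, (∑ i, f i * g i).eval t = ∑ i, (f i).eval t * (g i).eval t := by
  have h : ∀ᶠ t : ℝ in atTop, ∀ i, (f i * g i).eval t = (f i).eval t * (g i).eval t :=
    eventually_all.2 fun i => eventually_eval_mul _ _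
  filter_upwards [h, eventually_eval_sum Finset.univ fun i => f i * g i] with t h1 h2
  rw [h2]
  exact Finset.sum_congr rfl fun i _ => h1 i

/-- After division by `t^v`, with `v` the valuation, the value tends to the leading coefficient,
which is positive. -/
theorem eventually_eval_pos {x : Puiseux} (hx : 0 < x) : ∀ᶠ t : ℝ in atTop, 0 < x.eval t := by
  obtain ⟨v, hv⟩ := exists_val_eq hx.ne'
  obtain ⟨t₀, ht₀⟩ := (x.2.2.and (eventually_ge_atTop 1)).exists
  have hlim : Tendsto (fun t : ℝ => ∑' α : ℝ, coeffAt x.1 α * t ^ (α - v)) atTop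
      (𝓝 (∑' α : ℝ, if α = v then coeffAt x.1 v else 0)) := by
    -- Exponents above `v` do not occur, and for `α ≤ v` the power `t^(α - v)` decreases in `t`. The
    -- terms at one point `t₀ ≥ 1` of absolute convergence therefore dominate those at every `t ≥
    -- t₀`.
    refine tendsto_tsum_of_dominated_convergence
      (bound := fun α => |coeffAt x.1 α * t₀ ^ α| * |t₀ ^ (-v)|)
      (ht₀.1.mul_right _) (fun α => ?_) ?_
    · rcases lt_trichotomy α v with h | h | h
      · rw [if_neg h.ne]
        have := (tendsto_rpow_neg_atTop (sub_pos.2 h)).const_mul (coeffAt x.1 α)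
        simpa using this
      · subst h
        simp
      · simp [val_le_iff.1 hv.le α h, h.ne']
    · filter_upwards [eventually_ge_atTop t₀] with t ht α
      rcases le_or_gt α v with h | h
      · rw [Real.norm_eq_abs, ← abs_mul, mul_assoc, ← Real.rpow_add (by linarith [ht₀.2]),
          abs_mul, abs_mul, ← sub_eq_add_neg]
        refine mul_le_mul_of_nonneg_left ?_ (abs_nonneg _)
        have h0 : 0 < t₀ := by linarith [ht₀.2]
        rw [abs_of_pos (Real.rpow_pos_of_pos h0 _),
          abs_of_pos (Real.rpow_pos_of_pos (h0.trans_le ht) _)]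
        exact Real.rpow_le_rpow_of_nonpos h0 ht (by linarith)
      · simp [val_le_iff.1 hv.le α h]
  rw [tsum_ite_eq] at hlim
  filter_upwards [hlim.eventually (lt_mem_nhds (coeffAt_val_pos hx hv)), eventually_gt_atTop 0]
    with t h ht
  have : x.eval t = (∑' α : ℝ, coeffAt x.1 α * t ^ (α - v)) * t ^ v := by
    unfold eval
    rw [← tsum_mul_right]
    refine tsum_congr fun α => ?_
    rw [mul_assoc, ← Real.rpow_add ht, sub_add_cancel]
  rw [this]
  exact mul_pos h (Real.rpow_pos_of_pos ht _)

theorem eventually_eval_lt {x y : Puiseux} (h : x < y) :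
    ∀ᶠ t : ℝ in atTop, x.eval t < y.eval t := by
  filter_upwards [eventually_eval_pos (sub_pos.2 h), eventually_eval_sub y x] with t h1 h2
  linarith

theorem eventually_eval_le {x y : Puiseux} (h : x ≤ y) :
    ∀ᶠ t : ℝ in atTop, x.eval t ≤ y.eval t := by
  rcases h.eq_or_lt with rfl | h
  · simp
  · exact (eventually_eval_lt h).mono fun _ => le_of_lt

theorem eventually_eval_nonneg {x : Puiseux} (h : 0 ≤ x) :
    ∀ᶠ t : ℝ in atTop, 0 ≤ x.eval t := by
  simpa [eval_zero] using eventually_eval_le h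

/-- The way back from real inequalities to `𝕂`: the order is total, and a strict reverse inequality
would hold at all large `t`. -/
theorem le_of_frequently_eval_le {x y : Puiseux}
    (h : ∃ᶠ t : ℝ in atTop, x.eval t ≤ y.eval t) : x ≤ y := by
  by_contra hlt
  obtain ⟨t, h1, h2⟩ := (h.and_eventually (eventually_eval_lt (not_le.1 hlt))).exists
  exact h1.not_gt h2

end Puiseux

/-! ### Generators of polyhedral cones -/

/-- Real form of the double description step: a functional that is nonnegative on the generators
of the section of a cone by a half-space becomes nonnegative on the generators of the cone after
adding a nonnegative multiple of the functional defining the half-space. -/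
theorem exists_nonneg_multiplier {ι : Type*} (G : Finset ι) (s l : ι → ℝ)
    (h₁ : ∀ g ∈ G, s g ≤ 0 → 0 ≤ l g)
    (h₂ : ∀ g ∈ G, ∀ h ∈ G, 0 < s g → s h < 0 → 0 ≤ s g * l h - s h * l g) :
    ∃ τ : ℝ, 0 ≤ τ ∧ ∀ g ∈ G, 0 ≤ l g + τ * s g := by
  rcases (G.filter fun g => 0 < s g).eq_empty_or_nonempty with he | hne
  · refine ⟨0, le_rfl, fun g hg => ?_⟩
    have := Finset.filter_eq_empty_iff.1 he hg
    simpa using h₁ g hg (not_lt.1 this)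
  · obtain ⟨g₀, hg₀, hmax⟩ := Finset.exists_max_image _ (fun g => -l g / s g) hne
    obtain ⟨hg₀, hs₀⟩ := Finset.mem_filter.1 hg₀
    -- The least multiplier that works for all generators with `s > 0`. The pairwise hypothesis says
    -- exactly that it is not too large for those with `s < 0`.
    refine ⟨max 0 (-l g₀ / s g₀), le_max_left _ _, fun g hg => ?_⟩
    rcases lt_trichotomy (s g) 0 with hs | hs | hs
    · have hl := h₁ g hg hs.le
      rcases max_choice 0 (-l g₀ / s g₀) with h | h <;> rw [h]
      · simpa using hl
      · have := h₂ g₀ hg₀ g hg hs₀ hs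
        have h3 : l g + -l g₀ / s g₀ * s g = (s g₀ * l g - s g * l g₀) / s g₀ := by
          field_simp
          ring
        rw [h3]
        positivity
    · rw [hs, mul_zero, add_zero]
      exact h₁ g hg hs.le
    · have h3 : -l g / s g ≤ max 0 (-l g₀ / s g₀) :=
        (hmax g (Finset.mem_filter.2 ⟨hg, hs⟩)).trans (le_max_right _ _)
      rw [div_le_iff₀ hs] at h3
      linarith

/-- Entrywise evaluation of a vector of series. -/
def evalVec {J : Type*} (x : J → Puiseux) (t : ℝ) : J → ℝ := fun j => (x j).eval t

open Puiseux in
/-- A polyhedral cone over `𝕂` contains finitely many vectors whose values generate, in the sense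
of duality, the cone of the values at all large `t`. -/
theorem exists_cone_generators {J : Type*} [Fintype J] (R : Finset (J → Puiseux)) :
    ∃ G : Finset (J → Puiseux), (∀ g ∈ G, ∀ a ∈ R, a ⬝ᵥ g ≤ 0) ∧
      ∀ᶠ t : ℝ in atTop, ∀ x : J → ℝ, (∀ a ∈ R, evalVec a t ⬝ᵥ x ≤ 0) →
        ∀ L : (J → ℝ) →ₗ[ℝ] ℝ, (∀ g ∈ G, 0 ≤ L (evalVec g t)) → 0 ≤ L x := by
  classical
  induction R using Finset.induction_on with
  | empty =>
    -- Without constraints the cone is the whole space, generated by the vectors `±e_j`; a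
    -- functional nonnegative on these vanishes.
    refine ⟨Finset.univ.image (fun j => Pi.single j 1) ∪ Finset.univ.image
      (fun j => -Pi.single j 1), by simp, Eventually.of_forall fun t x _ L hL => ?_⟩
    have hL0 : ∀ j, L (Pi.single j 1) = 0 := by
      intro j
      have he : evalVec (Pi.single j (1 : Puiseux)) t = Pi.single j 1 := by
        ext k
        by_cases hk : k = j
        · subst hk; simp [evalVec, eval_one]
        · simp [evalVec, hk, eval_zero]
      have h1 := hL (Pi.single j 1) (by simp)
      have h2 := hL (-Pi.single j 1) (by simp)
      have he' : evalVec (-Pi.single j (1 : Puiseux)) t = -Pi.single j 1 := by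
        rw [← he]; ext k; exact eval_neg _ _
      rw [he] at h1
      rw [he', map_neg] at h2
      linarith
    rw [LinearMap.pi_apply_eq_sum_univ L x]
    refine Finset.sum_nonneg fun j _ => ?_
    have : (fun k => if j = k then (1 : ℝ) else 0) = Pi.single j 1 := by
      ext k; simp [Pi.single_apply, eq_comm]
    rw [this, hL0, smul_zero]
  | insert a R ha ih =>
    obtain ⟨G, hG, hev⟩ := ih
    -- For `p` and `q` strictly on opposite sides of the hyperplane `a = 0`, this is the nonnegative
    -- combination of them lying on the hyperplane.
    let C : (J → Puiseux) × (J → Puiseux) → (J → Puiseux) :=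
      fun p => (a ⬝ᵥ p.1) • p.2 - (a ⬝ᵥ p.2) • p.1
    let G₀ := G.filter fun g => a ⬝ᵥ g ≤ 0
    let D := (G ×ˢ G).filter fun p => 0 < a ⬝ᵥ p.1 ∧ a ⬝ᵥ p.2 < 0
    refine ⟨G₀ ∪ D.image C, ?_, ?_⟩
    · intro g hg r hr
      rcases Finset.mem_union.1 hg with hg | hg
      · obtain ⟨hg, hag⟩ := Finset.mem_filter.1 hg
        rcases Finset.mem_insert.1 hr with rfl | hr
        · exact hag
        · exact hG g hg r hr
      · obtain ⟨⟨p, q⟩, hpq, rfl⟩ := Finset.mem_image.1 hg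
        obtain ⟨hpq, h1, h2⟩ := Finset.mem_filter.1 hpq
        obtain ⟨hp, hq⟩ := Finset.mem_product.1 hpq
        have : r ⬝ᵥ C (p, q) = (a ⬝ᵥ p) * (r ⬝ᵥ q) - (a ⬝ᵥ q) * (r ⬝ᵥ p) := by
          simp only [C, dotProduct_sub, dotProduct_smul, smul_eq_mul]
        rw [this]
        rcases Finset.mem_insert.1 hr with rfl | hr
        · rw [mul_comm, sub_self]
        · have h3 := mul_nonpos_of_nonneg_of_nonpos h1.le (hG q hq r hr)
          have h4 := mul_nonneg_of_nonpos_of_nonpos h2.le (hG p hp r hr)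
          exact sub_nonpos.2 (h3.trans h4)
    · have e1 : ∀ᶠ t : ℝ in atTop, ∀ g ∈ G, (a ⬝ᵥ g).eval t = evalVec a t ⬝ᵥ evalVec g t :=
        (eventually_all_finset G).2 fun g _ => eventually_eval_dot a g
      -- The sign of `a · g` over `𝕂` is its sign at all large `t`, so the generators selected over
      -- `𝕂` are those that the real double description step would select.
      have e2 : ∀ᶠ t : ℝ in atTop, ∀ g ∈ G, (evalVec a t ⬝ᵥ evalVec g t ≤ 0 → a ⬝ᵥ g ≤ 0) ∧
          (0 < evalVec a t ⬝ᵥ evalVec g t → 0 < a ⬝ᵥ g) ∧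
          (evalVec a t ⬝ᵥ evalVec g t < 0 → a ⬝ᵥ g < 0) := by
        refine (eventually_all_finset G).2 fun g _ => ?_
        have e := eventually_eval_dot a g
        rcases lt_trichotomy (a ⬝ᵥ g) 0 with h | h | h
        · filter_upwards [e, eventually_eval_lt h] with t h1 h2
          rw [eval_zero] at h2
          have h1' : (a ⬝ᵥ g).eval t = evalVec a t ⬝ᵥ evalVec g t := h1
          rw [← h1']
          exact ⟨fun _ => h.le, fun h3 => absurd h3 h2.not_gt, fun _ => h⟩
        · filter_upwards [e] with t h1
          have h1' : (a ⬝ᵥ g).eval t = evalVec a t ⬝ᵥ evalVec g t := h1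
          rw [← h1', h, eval_zero]
          exact ⟨fun _ => le_rfl, fun h => absurd h (lt_irrefl _), fun h => absurd h (lt_irrefl _)⟩
        · filter_upwards [e, eventually_eval_lt h] with t h1 h2
          rw [eval_zero] at h2
          have h1' : (a ⬝ᵥ g).eval t = evalVec a t ⬝ᵥ evalVec g t := h1
          rw [← h1']
          exact ⟨fun h3 => absurd h3 h2.not_ge, fun _ => h, fun h3 => absurd h3 h2.not_gt⟩
      have e3 : ∀ᶠ t : ℝ in atTop, ∀ g ∈ G, ∀ h ∈ G, evalVec (C (g, h)) t =
          (evalVec a t ⬝ᵥ evalVec g t) • evalVec h t -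
            (evalVec a t ⬝ᵥ evalVec h t) • evalVec g t := by
        refine (eventually_all_finset G).2 fun g hg => (eventually_all_finset G).2 fun h hh => ?_
        have e4 : ∀ᶠ t : ℝ in atTop, ∀ j, evalVec (C (g, h)) t j =
            (a ⬝ᵥ g).eval t * (h j).eval t - (a ⬝ᵥ h).eval t * (g j).eval t := by
          refine eventually_all.2 fun j => ?_
          filter_upwards [eventually_eval_sub ((a ⬝ᵥ g) * h j) ((a ⬝ᵥ h) * g j),
            eventually_eval_mul (a ⬝ᵥ g) (h j), eventually_eval_mul (a ⬝ᵥ h) (g j)] with t h1 h2 h3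
          rw [← h2, ← h3, ← h1]
          rfl
        filter_upwards [e1, e4] with t h1 h2
        ext j
        rw [h2 j, h1 g hg, h1 h hh]
        rfl
      filter_upwards [hev, e2, e3] with t h1 h2 h3 x hx L hL
      obtain ⟨τ, hτ, hτG⟩ := exists_nonneg_multiplier G
        (fun g => evalVec a t ⬝ᵥ evalVec g t) (fun g => L (evalVec g t))
        (fun g hg hs => hL g (Finset.mem_union_left _
          (Finset.mem_filter.2 ⟨hg, (h2 g hg).1 hs⟩)))
        (fun g hg h hh hs hs' => by
          have := hL (C (g, h)) (Finset.mem_union_right _ (Finset.mem_image_of_mem _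
            (Finset.mem_filter.2 ⟨Finset.mem_product.2 ⟨hg, hh⟩,
              (h2 g hg).2.1 hs, (h2 h hh).2.2 hs'⟩)))
          rw [h3 g hg h hh] at this
          simpa using this)
      let La : (J → ℝ) →ₗ[ℝ] ℝ := ∑ j, evalVec a t j • LinearMap.proj j
      have hLa : ∀ y, La y = evalVec a t ⬝ᵥ y := fun y => by
        simp [La, dotProduct, LinearMap.sum_apply]
      -- The induction hypothesis applies to `L + τ a`. Since `τ ≥ 0` and `a · x ≤ 0`, removing the
      -- added term can only increase the value at `x`.
      have h4 := h1 x (fun r hr => hx r (Finset.mem_insert_of_mem hr)) (L + τ • La)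
        (fun g hg => by simpa [hLa] using hτG g hg)
      have h5 := mul_nonpos_of_nonneg_of_nonpos hτ (hx a (Finset.mem_insert_self _ _))
      simp only [LinearMap.add_apply, LinearMap.smul_apply, hLa, smul_eq_mul] at h4
      linarith

/-- The homogeneous coordinates `(1, x)` of a point. -/
def homog {R : Type*} [One R] {n : ℕ} (x : Fin n → R) : Option (Fin n) → R := fun o => o.elim 1 x

/-- The points of the cone over the polyhedron `A x ≤ b`. -/
def homogCone {m n : ℕ} (A : Matrix (Fin m) (Fin n) Puiseux) (b : Fin m → Puiseux) :
    Set (Option (Fin n) → Puiseux) :=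
  {g | 0 ≤ g none ∧ ∀ i, ∑ j, A i j * g (some j) ≤ b i * g none}

/-- The double description applied to the homogenized system `-x₀ ≤ 0`, `A x - b x₀ ≤ 0`. Zero
generators are discarded so that every remaining one has a coordinate of finite valuation. -/
theorem exists_polyhedron_generators {m n : ℕ} (A : Matrix (Fin m) (Fin n) Puiseux)
    (b : Fin m → Puiseux) :
    ∃ G : Finset (Option (Fin n) → Puiseux), (∀ g ∈ G, g ∈ homogCone A b ∧ g ≠ 0) ∧
      ∀ᶠ t : ℝ in atTop, ∀ x ∈ polyhedronAt A b t,
        ∀ L : (Option (Fin n) → ℝ) →ₗ[ℝ] ℝ, (∀ g ∈ G, 0 ≤ L (evalVec g t)) →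
          0 ≤ L (homog x) := by
  classical
  let row : Option (Fin m) → Option (Fin n) → Puiseux := fun o =>
    o.elim (fun p => p.elim (-1) 0) fun i p => p.elim (-b i) (A i)
  obtain ⟨G, hG, hev⟩ := exists_cone_generators (Finset.univ.image row)
  refine ⟨G.filter (· ≠ 0), fun g hg => ?_, ?_⟩
  · obtain ⟨hg, hg0⟩ := Finset.mem_filter.1 hg
    refine ⟨⟨?_, fun i => ?_⟩, hg0⟩
    · have := hG g hg (row none) (by simp)
      simp only [row, dotProduct, Fintype.sum_option, Option.elim, Pi.zero_apply, zero_mul,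
        Finset.sum_const_zero] at this
      linarith
    · have := hG g hg (row (some i)) (by simp)
      simp only [row, dotProduct, Fintype.sum_option, Option.elim] at this
      linarith
  · filter_upwards [hev] with t ht x hx L hL
    refine ht (homog x) ?_ L fun g hg => ?_
    · intro a ha
      obtain ⟨o, -, rfl⟩ := Finset.mem_image.1 ha
      cases o with
      | none =>
        simp [row, dotProduct, Fintype.sum_option, evalVec, homog, Puiseux.eval_neg,
          Puiseux.eval_one, Puiseux.eval_zero]
      | some i =>
        have := hx i
        simpa [row, dotProduct, Fintype.sum_option, evalVec, homog, Puiseux.eval_neg] using this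
    · by_cases h0 : g = 0
      · have : evalVec g t = 0 := by
          ext o
          simp [h0, evalVec, Puiseux.eval_zero]
        rw [this, map_zero]
      · exact hL g (Finset.mem_filter.2 ⟨hg, h0⟩)

/-! ### Tropical polyhedra -/

/-- The tropical inverse of a finite scalar (with value `0` at `-∞`). -/
def tropInv (a : Trop) : Trop := ((-(a.unbotD 0) : ℝ) : Trop)

theorem add_tropInv {a : Trop} (ha : a ≠ ⊥) : a + tropInv a = 0 := by
  obtain ⟨r, rfl⟩ := WithBot.ne_bot_iff_exists.1 ha
  unfold tropInv
  rw [WithBot.unbotD_coe, ← WithBot.coe_add, add_neg_cancel]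
  rfl

/-- The homogeneous coordinates `(0, y)` of a point of `𝕋ⁿ`. -/
def tropHomog {n : ℕ} (y : Fin n → Trop) : Option (Fin n) → Trop := fun o => o.elim 0 y

theorem sup_add_trop {ι : Type*} (s : Finset ι) (f : ι → Trop) (a : Trop) :
    s.sup f + a = s.sup fun i => f i + a :=
  Finset.apply_sup_eq_sup_comp (g := fun x : Trop => x + a)
    (fun x y => (max_add_add_right x y a).symm) (WithBot.bot_add a)

/-- A vector satisfying the canonical inequalities of a finitely generated tropical cone is a
tropical linear combination of the generators. -/
theorem exists_trop_combination {K J : Type*} [Fintype K] [Fintype J] (v : K → J → Trop)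
    (hv : ∀ k, ∃ j, v k j ≠ ⊥) (y : J → Trop)
    (h : ∀ (i : J) (φ : K → J), (∀ k, v k (φ k) ≠ ⊥) →
      y i ≤ Finset.univ.sup fun k => v k i + tropInv (v k (φ k)) + y (φ k)) :
    ∃ c : K → Trop, ∀ j, (Finset.univ.sup fun k => c k + v k j) = y j := by
  classical
  have hmin : ∀ k, ∃ j, v k j ≠ ⊥ ∧ ∀ j', v k j' ≠ ⊥ →
      y j + tropInv (v k j) ≤ y j' + tropInv (v k j') := by
    intro k
    obtain ⟨j₀, hj₀⟩ := hv k
    obtain ⟨j, hj, hm⟩ := Finset.exists_min_image (Finset.univ.filter fun j => v k j ≠ ⊥)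
      (fun j => y j + tropInv (v k j)) ⟨j₀, by simpa using hj₀⟩
    exact ⟨j, by simpa using hj, fun j' hj' => hm j' (by simpa using hj')⟩
  choose φ hφ hm using hmin
  -- Residuation: `φ k` minimizes `y j - v k j` over the finite entries of `v k`, so this is the
  -- greatest coefficient with `c k + v k ≤ y`. The canonical inequalities for this `φ` give the
  -- reverse bound.
  refine ⟨fun k => y (φ k) + tropInv (v k (φ k)), fun j => le_antisymm ?_ ?_⟩
  · refine Finset.sup_le fun k _ => ?_
    by_cases hk : v k j = ⊥
    · simp [hk]
    · calc y (φ k) + tropInv (v k (φ k)) + v k j ≤ y j + tropInv (v k j) + v k j :=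
            add_le_add_left (hm k j hk) _
        _ = y j := by rw [add_assoc, add_comm (tropInv _), add_tropInv hk, add_zero]
  · refine (h j φ hφ).trans_eq (Finset.sup_congr rfl fun k _ => ?_)
    change _ = y (φ k) + tropInv (v k (φ k)) + v k j
    ac_rfl

theorem isTropicalPolyhedron_of_fintype {n : ℕ} {ι : Type*} [Fintype ι] (α₀ β₀ : ι → Trop)
    (α β : ι → Fin n → Trop) : IsTropicalPolyhedron
      {x : Fin n → Trop | ∀ j, α₀ j ⊔ tropDot (α j) x ≤ β₀ j ⊔ tropDot (β j) x} := by
  let e := (Fintype.equivFin ι).symm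
  refine ⟨Fintype.card ι, α₀ ∘ e, β₀ ∘ e, fun j => α (e j), fun j => β (e j), ?_⟩
  ext x
  exact ⟨fun h j => h (e j), fun h j => by simpa using h (e.symm j)⟩

theorem IsTropicalPolyhedron.inter {n : ℕ} {S T : Set (Fin n → Trop)}
    (hS : IsTropicalPolyhedron S) (hT : IsTropicalPolyhedron T) :
    IsTropicalPolyhedron (S ∩ T) := by
  obtain ⟨k, α₀, β₀, α, β, rfl⟩ := hS
  obtain ⟨l, α₀', β₀', α', β', rfl⟩ := hT
  have := isTropicalPolyhedron_of_fintype (ι := Fin k ⊕ Fin l) (Sum.elim α₀ α₀')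
    (Sum.elim β₀ β₀') (Sum.elim α α') (Sum.elim β β')
  convert this using 1
  ext x
  simp [Sum.forall]

theorem isTropicalPolyhedron_tropDot_le {n : ℕ} (a : Fin n → Trop) (r : Trop) :
    IsTropicalPolyhedron {x : Fin n → Trop | tropDot a x ≤ r} := by
  refine ⟨1, fun _ => ⊥, fun _ => r, fun _ => a, fun _ _ => ⊥, ?_⟩
  ext x
  simp [tropDot]

theorem sup_tropHomog {n : ℕ} (α : Option (Fin n) → Trop) (y : Fin n → Trop) :
    (Finset.univ.sup fun o => α o + tropHomog y o) =
      α none ⊔ tropDot (fun j => α (some j)) y := by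
  apply le_antisymm
  · refine Finset.sup_le fun o _ => ?_
    cases o with
    | none => exact le_sup_of_le_left (by simp [tropHomog])
    | some j =>
      exact le_sup_of_le_right
        (Finset.le_sup (f := fun j => α (some j) + y j) (Finset.mem_univ j))
  · refine sup_le ?_ (Finset.sup_le fun j _ => ?_)
    · simpa [tropHomog] using
        Finset.le_sup (f := fun o => α o + tropHomog y o) (Finset.mem_univ none)
    · exact Finset.le_sup (f := fun o => α o + tropHomog y o) (Finset.mem_univ (some j))

/-- Dehomogenized finitely generated tropical cones are tropical polyhedra. -/
theorem isTropicalPolyhedron_canonical {n : ℕ} {K : Type*} [Fintype K]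
    (v : K → Option (Fin n) → Trop) : IsTropicalPolyhedron
      {y : Fin n → Trop | ∀ (i : Option (Fin n)) (φ : K → Option (Fin n)),
        (∀ k, v k (φ k) ≠ ⊥) → tropHomog y i ≤
          Finset.univ.sup fun k => v k i + tropInv (v k (φ k)) + tropHomog y (φ k)} := by
  classical
  let ι := Option (Fin n) × {φ : K → Option (Fin n) // ∀ k, v k (φ k) ≠ ⊥}
  -- Each canonical inequality becomes a tropical linear one in the homogeneous coordinates. On the
  -- right, all `k` with the same `φ k` contribute to one coefficient.
  let α : ι → Option (Fin n) → Trop := fun p o => if o = p.1 then 0 else ⊥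
  let β : ι → Option (Fin n) → Trop := fun p o =>
    Finset.univ.sup fun k => if p.2.1 k = o then v k p.1 + tropInv (v k (p.2.1 k)) else ⊥
  have hα : ∀ p y, (Finset.univ.sup fun o => α p o + tropHomog y o) = tropHomog y p.1 := by
    intro p y
    apply le_antisymm
    · refine Finset.sup_le fun o _ => ?_
      by_cases h : o = p.1 <;> simp [α, h]
    · refine le_trans (by simp [α]) (Finset.le_sup (f := fun o => α p o + tropHomog y o)
        (Finset.mem_univ p.1))
  have hβ : ∀ p y, (Finset.univ.sup fun o => β p o + tropHomog y o) =
      Finset.univ.sup fun k => v k p.1 + tropInv (v k (p.2.1 k)) + tropHomog y (p.2.1 k) := by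
    intro p y
    simp only [β, sup_add_trop]
    apply le_antisymm
    · refine Finset.sup_le fun o _ => Finset.sup_le fun k hk => ?_
      by_cases h : p.2.1 k = o
      · rw [if_pos h, ← h]
        exact Finset.le_sup (f := fun k => v k p.1 + tropInv (v k (p.2.1 k)) +
          tropHomog y (p.2.1 k)) hk
      · simp [h]
    · refine Finset.sup_le fun k hk => ?_
      refine le_trans ?_ (Finset.le_sup (f := fun o => Finset.univ.sup fun k =>
        (if p.2.1 k = o then v k p.1 + tropInv (v k (p.2.1 k)) else ⊥) + tropHomog y o)
        (Finset.mem_univ (p.2.1 k)))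
      refine le_trans ?_ (Finset.le_sup hk)
      simp
  convert isTropicalPolyhedron_of_fintype (fun p => α p none) (fun p => β p none)
    (fun p j => α p (some j)) (fun p j => β p (some j)) using 1
  ext y
  simp only [Set.mem_ofPred_eq, ← sup_tropHomog, hα, hβ]
  exact ⟨fun h p => h p.1 p.2.1 p.2.2, fun h i φ hφ => h (i, ⟨φ, hφ⟩)⟩

/-! ### Valuations of polyhedra -/

section Valuation

open Puiseux

/-- The monic monomial of a given valuation. -/
def Puiseux.lift (a : Trop) : Puiseux := WithBot.recBotCoe 0 (monomial 1) a

theorem Puiseux.val_lift (a : Trop) : (lift a).val = a := by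
  induction a using WithBot.recBotCoe with
  | bot => exact val_zero
  | coe r => exact val_monomial one_ne_zero r

theorem Puiseux.lift_nonneg (a : Trop) : 0 ≤ lift a := by
  induction a using WithBot.recBotCoe with
  | bot => exact le_rfl
  | coe r => exact (monomial_pos one_pos r).le

/-- Normalization without inverting `s`: if `s ≤ r t^v` with `v` its valuation, the monomial `r⁻¹
t^(-v)` serves. -/
theorem Puiseux.exists_scale {s : Puiseux} (hs : 0 < s) :
    ∃ u, 0 < u ∧ u * s ≤ 1 ∧ u.val + s.val = 0 := by
  obtain ⟨v, hv⟩ := exists_val_eq hs.ne'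
  obtain ⟨r, hr, hle⟩ := exists_le_monomial_mul (p := s) (monomial_pos one_pos v)
    (by rw [hv, val_monomial one_ne_zero])
  refine ⟨monomial r⁻¹ (-v), monomial_pos (inv_pos.2 hr) _, ?_, ?_⟩
  · refine (mul_le_mul_of_nonneg_left hle (monomial_pos (inv_pos.2 hr) _).le).trans_eq ?_
    rw [monomial_mul, monomial_mul, ← monomial_one_zero]
    congr 1
    · field_simp
    · ring
  · rw [hv, val_monomial (inv_ne_zero hr.ne'), ← WithBot.coe_add, neg_add_cancel]
    rfl

variable {m n : ℕ} {A : Matrix (Fin m) (Fin n) Puiseux} {b : Fin m → Puiseux}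

theorem nonneg_of_zero_mem_polyhedron (hzero : (0 : Fin n → Puiseux) ∈ polyhedron A b)
    (i : Fin m) : 0 ≤ b i := by
  simpa using hzero i

/-- Since `0 ∈ P` forces `b ≥ 0`, it is enough that the homogenizing coordinate be at most `1` after
scaling. -/
theorem smul_mem_polyhedron (hzero : (0 : Fin n → Puiseux) ∈ polyhedron A b)
    {g : Option (Fin n) → Puiseux} (hg : g ∈ homogCone A b) {u : Puiseux} (hu : 0 ≤ u)
    (h : u * g none ≤ 1) : (fun j => u * g (some j)) ∈ polyhedron A b := by
  intro i
  have h1 := mul_le_mul_of_nonneg_left (hg.2 i) hu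
  have h2 := mul_le_mul_of_nonneg_left h (nonneg_of_zero_mem_polyhedron hzero i)
  calc ∑ j, A i j * (u * g (some j)) = u * ∑ j, A i j * g (some j) := by
        rw [Finset.mul_sum]; exact Finset.sum_congr rfl fun j _ => by ring
    _ ≤ u * (b i * g none) := h1
    _ = b i * (u * g none) := by ring
    _ ≤ b i * 1 := h2
    _ = b i := mul_one _

theorem homogCone_nonneg (hnonneg : ∀ x ∈ polyhedron A b, ∀ i, 0 ≤ x i)
    (hzero : (0 : Fin n → Puiseux) ∈ polyhedron A b)
    {g : Option (Fin n) → Puiseux} (hg : g ∈ homogCone A b) : ∀ o, 0 ≤ g o := by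
  obtain ⟨u, hu, hug⟩ : ∃ u, 0 < u ∧ u * g none ≤ 1 := by
    rcases hg.1.eq_or_lt with h | h
    -- A recession direction is itself a point of `P`, as `0 ∈ P`, so its coordinates are
    -- nonnegative too.
    · exact ⟨1, one_pos, by rw [← h, mul_zero]; exact zero_le_one⟩
    · obtain ⟨u, h1, h2, -⟩ := exists_scale h
      exact ⟨u, h1, h2⟩
  intro o
  cases o with
  | none => exact hg.1
  | some j =>
    exact nonneg_of_mul_nonneg_right (hnonneg _ (smul_mem_polyhedron hzero hg hu.le hug) j) hu

theorem homog_mem_homogCone {x : Fin n → Puiseux} (hx : x ∈ polyhedron A b) :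
    homog x ∈ homogCone A b :=
  ⟨zero_le_one, fun i => by simpa [homog] using hx i⟩

/-- The valuation of a point of the cone over a polyhedron, normalized by its first coordinate,
is the valuation of a point of the polyhedron. -/
theorem exists_mem_polyhedron_val (hzero : (0 : Fin n → Puiseux) ∈ polyhedron A b)
    {g : Option (Fin n) → Puiseux} (hg : g ∈ homogCone A b) (h0 : 0 < g none) :
    ∃ x ∈ polyhedron A b, ∀ j, (x j).val + (g none).val = (g (some j)).val := by
  obtain ⟨u, hu, hug, hval⟩ := exists_scale h0
  refine ⟨_, smul_mem_polyhedron hzero hg hu.le hug, fun j => ?_⟩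
  rw [val_mul, add_right_comm, hval, zero_add]

theorem eventually_evalVec_mem_polyhedronAt {x : Fin n → Puiseux} (hx : x ∈ polyhedron A b) :
    ∀ᶠ t : ℝ in atTop, evalVec x t ∈ polyhedronAt A b t := by
  refine eventually_all.2 fun i => ?_
  filter_upwards [eventually_eval_dot (A i) x, eventually_eval_le (hx i)] with t h1 h2
  exact h1.symm.trans_le h2

/-- `val P` is the dehomogenization of the tropical cone generated by the valuations of the
generators. In one direction, each canonical inequality is the valuation of a linear inequality true
on `P`. In the other, a tropical combination lifts to a nonnegative combination of generators, whose
leading terms cannot cancel. -/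
theorem isTropicalPolyhedron_valImage (hnonneg : ∀ x ∈ polyhedron A b, ∀ i, 0 ≤ x i)
    (hzero : (0 : Fin n → Puiseux) ∈ polyhedron A b) :
    IsTropicalPolyhedron (valImage (polyhedron A b)) := by
  classical
  obtain ⟨G, hG, hev⟩ := exists_polyhedron_generators A b
  let v : G → Option (Fin n) → Trop := fun k o => (k.1 o).val
  have hGnn : ∀ (k : G) o, 0 ≤ k.1 o := fun k => homogCone_nonneg hnonneg hzero (hG k.1 k.2).1
  convert isTropicalPolyhedron_canonical v using 1
  ext y
  constructor
  · rintro ⟨x, hx, rfl⟩ i φ hφ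
    -- The multiplier `q k` is a monomial of tropical size `v k i - v k (φ k)`, with a real
    -- coefficient large enough that its term alone dominates coordinate `i` of the generator `k`.
    have hbound : ∀ k : G, ∃ q : Puiseux, 0 ≤ q ∧ q.val = v k i + tropInv (v k (φ k)) ∧
        k.1 i ≤ q * k.1 (φ k) := by
      intro k
      by_cases hki : k.1 i = 0
      · refine ⟨0, le_rfl, ?_, by rw [hki, zero_mul]⟩
        simp [v, hki]
      · have hpos : 0 < lift (v k i + tropInv (v k (φ k))) * k.1 (φ k) := by
          refine lt_of_le_of_ne (mul_nonneg (lift_nonneg _) (hGnn k _)) (Ne.symm ?_)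
          rw [Ne, ← val_eq_bot_iff, val_mul, val_lift, add_assoc, add_comm (tropInv _)]
          change ¬ v k i + (v k (φ k) + _) = ⊥
          rw [add_tropInv (hφ k), add_zero]
          exact mt val_eq_bot_iff.1 hki
        obtain ⟨r, hr, hle⟩ := exists_le_monomial_mul (p := k.1 i) hpos (by
          rw [val_mul, val_lift, add_assoc, add_comm (tropInv _)]
          change v k i ≤ v k i + (v k (φ k) + _)
          rw [add_tropInv (hφ k), add_zero])
        refine ⟨monomial r 0 * lift (v k i + tropInv (v k (φ k))),
          mul_nonneg (monomial_pos hr 0).le (lift_nonneg _), ?_, by rwa [mul_assoc]⟩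
        rw [val_mul, val_lift, val_monomial hr.ne']
        exact zero_add _
    choose q hq0 hqv hqle using hbound
    have hxnn : ∀ o, 0 ≤ homog x o :=
      homogCone_nonneg hnonneg hzero (homog_mem_homogCone hx)
    -- The inequality holds on every generator, hence by duality on `P(t)` for large `t`, and
    -- finally over `𝕂`.
    have hle : homog x i ≤ ∑ k : G, q k * homog x (φ k) := by
      apply le_of_frequently_eval_le
      apply Eventually.frequently
      have e1 : ∀ᶠ t : ℝ in atTop, ∀ k : G, 0 ≤ (q k).eval t :=
        eventually_all.2 fun k => eventually_eval_nonneg (hq0 k)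
      have e2 : ∀ᶠ t : ℝ in atTop, ∀ (k : G) (o : Option (Fin n)), 0 ≤ (k.1 o).eval t :=
        eventually_all.2 fun k => eventually_all.2 fun o => eventually_eval_nonneg (hGnn k o)
      have e3 : ∀ᶠ t : ℝ in atTop, ∀ k : G, (k.1 i).eval t ≤ (q k).eval t * (k.1 (φ k)).eval t :=
        eventually_all.2 fun k => by
          filter_upwards [eventually_eval_le (hqle k), eventually_eval_mul (q k) (k.1 (φ k))]
            with t h1 h2
          rwa [← h2]
      filter_upwards [hev, e1, e2, e3, eventually_evalVec_mem_polyhedronAt hx,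
        eventually_eval_dot q fun k => homog x (φ k)] with t h h1 h2 h3 h4 h5
      have hh : ∀ o, homog (evalVec x t) o = (homog x o).eval t := by
        intro o
        cases o with
        | none => exact (eval_one t).symm
        | some j => rfl
      have := h _ h4 (∑ k : G, (q k).eval t • LinearMap.proj (φ k) - LinearMap.proj i) ?_
      · rw [h5]
        simpa [LinearMap.sum_apply, hh] using this
      · intro g hg
        have h6 : (g i).eval t ≤ ∑ k : G, (q k).eval t * (g (φ k)).eval t :=
          (h3 ⟨g, hg⟩).trans (Finset.single_le_sum
            (f := fun k : G => (q k).eval t * (g (φ k)).eval t)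
            (fun k _ => mul_nonneg (h1 k) (h2 ⟨g, hg⟩ _)) (Finset.mem_univ (⟨g, hg⟩ : G)))
        simpa [LinearMap.sum_apply, evalVec] using h6
    have hval := val_mono (hxnn i) hle
    rw [val_sum_of_nonneg _ _ fun k _ => mul_nonneg (hq0 k) (hxnn _)] at hval
    have hh : ∀ o, (homog x o).val = tropHomog (fun j => (x j).val) o := by
      intro o
      cases o with
      | none => exact val_monomial one_ne_zero 0
      | some j => rfl
    simpa only [val_mul, hqv, hh] using hval
  · intro hy
    obtain ⟨c, hc⟩ := exists_trop_combination v (fun k => by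
      by_contra hcon
      push Not at hcon
      exact (hG k.1 k.2).2 (funext fun o => val_eq_bot_iff.1 (hcon o))) (tropHomog y) hy
    let z : Option (Fin n) → Puiseux := fun o => ∑ k : G, lift (c k) * k.1 o
    have hz : z ∈ homogCone A b := by
      refine ⟨Finset.sum_nonneg fun k _ => mul_nonneg (lift_nonneg _) (hGnn k _), fun i => ?_⟩
      calc ∑ j, A i j * z (some j) = ∑ k : G, lift (c k) * ∑ j, A i j * k.1 (some j) := by
            simp only [z, Finset.mul_sum]
            rw [Finset.sum_comm]
            exact Finset.sum_congr rfl fun k _ => Finset.sum_congr rfl fun j _ => by ring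
        _ ≤ ∑ k : G, lift (c k) * (b i * k.1 none) :=
            Finset.sum_le_sum fun k _ =>
              mul_le_mul_of_nonneg_left ((hG k.1 k.2).1.2 i) (lift_nonneg _)
        _ = b i * z none := by
            simp only [z, Finset.mul_sum]
            exact Finset.sum_congr rfl fun k _ => by ring
    have hzval : ∀ o, (z o).val = tropHomog y o := by
      intro o
      rw [← hc o, val_sum_of_nonneg _ _ fun k _ => mul_nonneg (lift_nonneg _) (hGnn k _)]
      simp only [val_mul, val_lift, v]
    have hz0 : 0 < z none := by
      refine lt_of_le_of_ne hz.1 (Ne.symm ?_)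
      rw [Ne, ← val_eq_bot_iff, hzval]
      exact WithBot.coe_ne_bot
    obtain ⟨x, hx, hxv⟩ := exists_mem_polyhedron_val hzero hz hz0
    refine ⟨x, hx, funext fun j => ?_⟩
    have := hxv j
    rw [hzval, hzval] at this
    simpa [tropHomog] using this

end Valuation

/-! ### Exponential distributions on convex subsets of the orthant -/

section Exponential

variable {n : ℕ}

/-- The nonnegative orthant. -/
def orthant (n : ℕ) : Set (Fin n → ℝ) := Set.pi Set.univ fun _ => Set.Ici 0

theorem exp_neg_dot (w x : Fin n → ℝ) :
    Real.exp (-(w ⬝ᵥ x)) = ∏ i, Real.exp (-w i * x i) := by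
  rw [← Real.exp_sum, dotProduct, ← Finset.sum_neg_distrib]
  simp only [neg_mul]

theorem integrableOn_orthant_exp {w : Fin n → ℝ} (hw : ∀ i, 0 < w i) :
    IntegrableOn (fun x => Real.exp (-(w ⬝ᵥ x))) (orthant n) := by
  simp only [exp_neg_dot]
  rw [IntegrableOn, orthant, volume_pi, Measure.restrict_pi_pi]
  refine Integrable.fintype_prod (f := fun i x => Real.exp (-w i * x)) fun i => ?_
  exact (integrableOn_Ici_iff_integrableOn_Ioi (by simp)).2
    (integrableOn_exp_mul_Ioi (by linarith [hw i]) 0)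

theorem integral_orthant_exp {w : Fin n → ℝ} (hw : ∀ i, 0 < w i) :
    ∫ x in orthant n, Real.exp (-(w ⬝ᵥ x)) = ∏ i, (w i)⁻¹ := by
  simp only [exp_neg_dot]
  rw [orthant, volume_pi, Measure.restrict_pi_pi,
    integral_fintype_prod_eq_prod (f := fun i x => Real.exp (-w i * x))]
  refine Finset.prod_congr rfl fun i _ => ?_
  rw [integral_Ici_eq_integral_Ioi, integral_exp_mul_Ioi (by linarith [hw i])]
  simp

/-- Half of the decay rate in direction `i` pays for the factor `x i`, by `s + 1 ≤ exp s` at `s = w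
i * x i / 2`. -/
theorem mul_exp_neg_dot_le {w x : Fin n → ℝ} (i : Fin n) (hw : 0 < w i) :
    x i * Real.exp (-(w ⬝ᵥ x)) ≤
      2 / w i * Real.exp (-(Function.update w i (w i / 2) ⬝ᵥ x)) := by
  classical
  have h1 : w ⬝ᵥ x = Function.update w i (w i / 2) ⬝ᵥ x + w i / 2 * x i := by
    have : w = Function.update w i (w i / 2) + Pi.single i (w i / 2) := by
      ext j
      by_cases h : j = i
      · subst h; simp
      · simp [h]
    nth_rewrite 1 [this]
    rw [add_dotProduct, single_dotProduct]
  have h2 : x i ≤ 2 / w i * Real.exp (w i / 2 * x i) := by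
    rw [div_mul_eq_mul_div, le_div_iff₀ hw]
    have := Real.add_one_le_exp (w i / 2 * x i)
    linarith
  calc x i * Real.exp (-(w ⬝ᵥ x)) ≤ 2 / w i * Real.exp (w i / 2 * x i) * Real.exp (-(w ⬝ᵥ x)) :=
        mul_le_mul_of_nonneg_right h2 (Real.exp_pos _).le
    _ = _ := by
        rw [mul_assoc, ← Real.exp_add, h1]
        congr 2
        ring

theorem update_half_pos {w : Fin n → ℝ} (hw : ∀ i, 0 < w i) (i j : Fin n) :
    0 < Function.update w i (w i / 2) j := by
  by_cases h : j = i
  · subst h; simpa using half_pos (hw j)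
  · simpa [h] using hw j

theorem integrableOn_orthant_mul_exp {w : Fin n → ℝ} (hw : ∀ i, 0 < w i) (i : Fin n) :
    IntegrableOn (fun x => x i * Real.exp (-(w ⬝ᵥ x))) (orthant n) := by
  have hmeas : MeasurableSet (orthant n) :=
    MeasurableSet.univ_pi fun _ => measurableSet_Ici
  refine Integrable.mono' ((integrableOn_orthant_exp (update_half_pos hw i)).const_mul (2 / w i))
    (Continuous.aestronglyMeasurable (by unfold dotProduct; fun_prop)) ?_
  refine (ae_restrict_iff' hmeas).2 (Eventually.of_forall fun x hx => ?_)
  rw [Real.norm_eq_abs, abs_of_nonneg (mul_nonneg (hx i trivial) (Real.exp_pos _).le)]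
  exact mul_exp_neg_dot_le i (hw i)

/-- The total mass of the density `exp (-⟨w, x⟩)` on `K`. -/
def expMass (K : Set (Fin n → ℝ)) (w : Fin n → ℝ) : ℝ := ∫ x in K, Real.exp (-(w ⬝ᵥ x))

/-- The mean of the probability distribution on `K` with density proportional to
`exp (-⟨w, x⟩)`. -/
def expMean (K : Set (Fin n → ℝ)) (w : Fin n → ℝ) : Fin n → ℝ :=
  fun i => (∫ x in K, x i * Real.exp (-(w ⬝ᵥ x))) / expMass K w

variable {K : Set (Fin n → ℝ)} {w : Fin n → ℝ}

theorem expMass_pos (hK : K ⊆ orthant n) (hne : (interior K).Nonempty) (hw : ∀ i, 0 < w i) :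
    0 < expMass K w := by
  refine (setIntegral_pos_iff_support_of_nonneg_ae
    (Eventually.of_forall fun x => (Real.exp_pos _).le)
    ((integrableOn_orthant_exp hw).mono_set hK)).2 ?_
  have : Function.support (fun x : Fin n → ℝ => Real.exp (-(w ⬝ᵥ x))) = Set.univ := by
    ext x; simp [Real.exp_ne_zero]
  rw [this, Set.univ_inter]
  exact (isOpen_interior.measure_pos volume hne).trans_le (measure_mono interior_subset)

theorem integrableOn_dot_mul_exp (hK : K ⊆ orthant n) (hw : ∀ i, 0 < w i) (a : Fin n → ℝ) :
    IntegrableOn (fun x => (a ⬝ᵥ x) * Real.exp (-(w ⬝ᵥ x))) K := by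
  have : (fun x : Fin n → ℝ => (a ⬝ᵥ x) * Real.exp (-(w ⬝ᵥ x))) =
      fun x => ∑ i, a i * (x i * Real.exp (-(w ⬝ᵥ x))) := by
    ext x
    rw [dotProduct, Finset.sum_mul]
    exact Finset.sum_congr rfl fun i _ => by ring
  rw [this]
  exact integrable_finsetSum _ fun i _ =>
    ((integrableOn_orthant_mul_exp hw i).mono_set hK).const_mul _

theorem integral_dot_mul_exp (hK : K ⊆ orthant n) (hne : (interior K).Nonempty)
    (hw : ∀ i, 0 < w i) (a : Fin n → ℝ) :
    ∫ x in K, (a ⬝ᵥ x) * Real.exp (-(w ⬝ᵥ x)) = (a ⬝ᵥ expMean K w) * expMass K w := by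
  have : (fun x : Fin n → ℝ => (a ⬝ᵥ x) * Real.exp (-(w ⬝ᵥ x))) =
      fun x => ∑ i, a i * (x i * Real.exp (-(w ⬝ᵥ x))) := by
    ext x
    rw [dotProduct, Finset.sum_mul]
    exact Finset.sum_congr rfl fun i _ => by ring
  rw [this, integral_finsetSum _ fun i _ =>
    ((integrableOn_orthant_mul_exp hw i).mono_set hK).const_mul _, dotProduct, Finset.sum_mul]
  refine Finset.sum_congr rfl fun i _ => ?_
  rw [integral_const_mul, expMean, mul_assoc,
    div_mul_cancel₀ _ (expMass_pos hK hne hw).ne']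

/-- Otherwise a linear functional attains on the interior only values strictly below its value at
the mean, so its average would be strictly smaller than its value at the mean. -/
theorem expMean_mem_interior (hconv : Convex ℝ K) (hK : K ⊆ orthant n)
    (hmeas : MeasurableSet K) (hne : (interior K).Nonempty) (hw : ∀ i, 0 < w i) :
    expMean K w ∈ interior K := by
  by_contra hmem
  obtain ⟨f, hf⟩ := geometric_hahn_banach_open_point hconv.interior isOpen_interior hmem
  let a : Fin n → ℝ := fun i => f (fun j => if i = j then 1 else 0)
  have hfa : ∀ x, f x = a ⬝ᵥ x := fun x => by
    have := LinearMap.pi_apply_eq_sum_univ (f : (Fin n → ℝ) →ₗ[ℝ] ℝ) x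
    simp only [ContinuousLinearMap.coe_coe, smul_eq_mul] at this
    rw [this, dotProduct]
    exact Finset.sum_congr rfl fun i _ => mul_comm _ _
  set z := expMean K w with hz
  have hle : ∀ x ∈ K, a ⬝ᵥ x ≤ a ⬝ᵥ z := by
    intro x hx
    have hx' : x ∈ closure (interior K) := by
      rw [hconv.closure_interior_eq_closure_of_nonempty_interior hne]
      exact subset_closure hx
    have : closure (interior K) ⊆ {y | f y ≤ f z} :=
      closure_minimal (fun y hy => (hf y hy).le)
        (isClosed_le f.continuous continuous_const)
    simpa [hfa] using this hx'
  have hi1 := ((integrableOn_orthant_exp hw).mono_set hK).const_mul (a ⬝ᵥ z)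
  have hi2 := integrableOn_dot_mul_exp hK hw a
  have hzero : ∫ x in K, ((a ⬝ᵥ z) * Real.exp (-(w ⬝ᵥ x)) -
      (a ⬝ᵥ x) * Real.exp (-(w ⬝ᵥ x))) = 0 := by
    rw [integral_sub hi1 hi2, integral_const_mul, integral_dot_mul_exp hK hne hw]
    exact sub_self _
  refine hzero.not_gt ((setIntegral_pos_iff_support_of_nonneg_ae ?_ (hi1.sub hi2)).2 ?_)
  · refine (ae_restrict_iff' hmeas).2 (Eventually.of_forall fun x hx => ?_)
    change 0 ≤ (a ⬝ᵥ z) * Real.exp (-(w ⬝ᵥ x)) - (a ⬝ᵥ x) * Real.exp (-(w ⬝ᵥ x))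
    rw [← sub_mul]
    exact mul_nonneg (sub_nonneg.2 (hle x hx)) (Real.exp_pos _).le
  · refine (isOpen_interior.measure_pos volume hne).trans_le (measure_mono fun x hx => ?_)
    refine ⟨?_, interior_subset hx⟩
    have hlt := hf x hx
    rw [hfa, hfa] at hlt
    change (a ⬝ᵥ z) * Real.exp (-(w ⬝ᵥ x)) - (a ⬝ᵥ x) * Real.exp (-(w ⬝ᵥ x)) ≠ 0
    rw [← sub_mul]
    exact (mul_pos (sub_pos.2 hlt) (Real.exp_pos _)).ne'

/-! ### The entropic central path -/

theorem logLaplace_neg (hK : K ⊆ orthant n) (hne : (interior K).Nonempty) (hw : ∀ i, 0 < w i) :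
    logLaplace K (-w) = (Real.log (expMass K w) : ℝ) := by
  unfold logLaplace
  have h : (fun x : Fin n → ℝ => ENNReal.ofReal (Real.exp (∑ i, (-w) i * x i))) =
      fun x => ENNReal.ofReal (Real.exp (-(w ⬝ᵥ x))) := by
    ext x
    rw [← neg_dotProduct, dotProduct]
  rw [h, ← ofReal_integral_eq_lintegral_ofReal ((integrableOn_orthant_exp hw).mono_set hK)
    (Eventually.of_forall fun x => (Real.exp_pos _).le)]
  exact ENNReal.log_ofReal_of_pos (expMass_pos hK hne hw)

/-- The supporting hyperplane of the convex function `logLaplace` at `-w`, whose slope is the mean.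
This is Jensen's inequality, obtained by integrating `exp u ≥ exp a * (1 + u - a)` for `u = ⟨θ + w,
x⟩` with mean `a`. -/
theorem le_logLaplace (hK : K ⊆ orthant n) (hne : (interior K).Nonempty)
    (hw : ∀ i, 0 < w i) (θ : Fin n → ℝ) :
    ((Real.log (expMass K w) + (θ + w) ⬝ᵥ expMean K w : ℝ) : EReal) ≤ logLaplace K θ := by
  have hZ := expMass_pos hK hne hw
  set a := (θ + w) ⬝ᵥ expMean K w with ha
  have hlog : ((Real.log (expMass K w) + a : ℝ) : EReal) =
      ENNReal.log (ENNReal.ofReal (expMass K w * Real.exp a)) := by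
    rw [ENNReal.log_ofReal_of_pos (by positivity), Real.log_mul hZ.ne' (Real.exp_pos _).ne',
      Real.log_exp]
  rw [hlog]
  unfold logLaplace
  refine ENNReal.log_monotone ?_
  have hi1 := ((integrableOn_orthant_exp hw).mono_set hK).const_mul (1 - a)
  have hi2 := integrableOn_dot_mul_exp hK hw (θ + w)
  have hi := (hi1.add hi2).const_mul (Real.exp a)
  have hmassint : ∫ x in K, Real.exp a * ((1 - a) * Real.exp (-(w ⬝ᵥ x)) +
      ((θ + w) ⬝ᵥ x) * Real.exp (-(w ⬝ᵥ x))) = expMass K w * Real.exp a := by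
    rw [integral_const_mul, integral_add hi1 hi2, integral_const_mul,
      integral_dot_mul_exp hK hne hw, ← ha]
    change _ * ((1 - a) * expMass K w + _) = _
    ring
  by_cases hfin : ∫⁻ x in K, ENNReal.ofReal (Real.exp (∑ i, θ i * x i)) = ⊤
  · rw [hfin]; exact le_top
  have hθ : IntegrableOn (fun x : Fin n → ℝ => Real.exp (∑ i, θ i * x i)) K := by
    refine ⟨Continuous.aestronglyMeasurable (by fun_prop), ?_⟩
    rw [hasFiniteIntegral_iff_ofReal (Eventually.of_forall fun x => (Real.exp_pos _).le)]
    exact lt_top_iff_ne_top.2 hfin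
  rw [← ofReal_integral_eq_lintegral_ofReal hθ
    (Eventually.of_forall fun x => (Real.exp_pos _).le), ← hmassint]
  refine ENNReal.ofReal_le_ofReal (integral_mono hi hθ fun x => ?_)
  change Real.exp a * ((1 - a) * Real.exp (-(w ⬝ᵥ x)) +
      ((θ + w) ⬝ᵥ x) * Real.exp (-(w ⬝ᵥ x))) ≤ Real.exp (θ ⬝ᵥ x)
  have h1 := Real.add_one_le_exp ((θ + w) ⬝ᵥ x - a)
  calc _ = Real.exp a * Real.exp (-(w ⬝ᵥ x)) * ((θ + w) ⬝ᵥ x - a + 1) := by ring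
    _ ≤ Real.exp a * Real.exp (-(w ⬝ᵥ x)) * Real.exp ((θ + w) ⬝ᵥ x - a) :=
        mul_le_mul_of_nonneg_left h1 (by positivity)
    _ = _ := by
        rw [← Real.exp_add, ← Real.exp_add, add_dotProduct]
        congr 1
        ring

theorem le_entropicBarrier (hK : K ⊆ orthant n) (hne : (interior K).Nonempty)
    (hw : ∀ i, 0 < w i) (x : Fin n → ℝ) :
    ((-(w ⬝ᵥ x) - Real.log (expMass K w) : ℝ) : EReal) ≤ entropicBarrier K x := by
  refine le_trans (le_of_eq ?_)
    (le_iSup (fun θ : Fin n → ℝ => ((∑ i, θ i * x i : ℝ) : EReal) - logLaplace K θ) (-w))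
  change _ = (((-w) ⬝ᵥ x : ℝ) : EReal) - _
  rw [logLaplace_neg hK hne hw, neg_dotProduct]
  rfl

/-- By the supporting hyperplane inequality, the supremum defining the barrier at the mean is
attained at `θ = -w`. -/
theorem entropicBarrier_expMean (hK : K ⊆ orthant n) (hne : (interior K).Nonempty)
    (hw : ∀ i, 0 < w i) :
    entropicBarrier K (expMean K w) =
      ((-(w ⬝ᵥ expMean K w) - Real.log (expMass K w) : ℝ) : EReal) := by
  refine le_antisymm (iSup_le fun θ => ?_) (le_entropicBarrier hK hne hw _)
  refine (EReal.sub_le_sub le_rfl (le_logLaplace hK hne hw θ)).trans (le_of_eq ?_)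
  change ((θ ⬝ᵥ expMean K w : ℝ) : EReal) - _ = _
  rw [← EReal.coe_sub, add_dotProduct]
  congr 1
  ring

theorem hasDerivAt_expMass (hK : K ⊆ orthant n) (hmeas : MeasurableSet K) (hw : ∀ i, 0 < w i)
    (i : Fin n) :
    HasDerivAt (fun s : ℝ => expMass K (w - Pi.single i s))
      (∫ x in K, x i * Real.exp (-(w ⬝ᵥ x))) 0 := by
  have hdot : ∀ (s : ℝ) (x : Fin n → ℝ), -((w - Pi.single i s) ⬝ᵥ x) = -(w ⬝ᵥ x) + s * x i := by
    intro s x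
    rw [sub_dotProduct, single_dotProduct]
    ring
  have hhalf : ∀ x : Fin n → ℝ,
      -(Function.update w i (w i / 2) ⬝ᵥ x) = -(w ⬝ᵥ x) + w i / 2 * x i := by
    intro x
    rw [← hdot]
    congr 2
    ext j
    by_cases h : j = i
    · subst h; simp; ring
    · simp [h]
  have key := hasDerivAt_integral_of_dominated_loc_of_deriv_le (μ := volume.restrict K)
    (F := fun s x => Real.exp (-(w ⬝ᵥ x) + s * x i))
    (F' := fun s x => x i * Real.exp (-(w ⬝ᵥ x) + s * x i)) (x₀ := (0 : ℝ))
    -- Below this threshold at least half of the rate in direction `i` survives, so the density with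
    -- halved rate dominates, as `x i ≥ 0` on `K`.
    (s := Set.Iio (w i / 2))
    (bound := fun x => x i * Real.exp (-(Function.update w i (w i / 2) ⬝ᵥ x)))
    (Iio_mem_nhds (half_pos (hw i)))
    (Eventually.of_forall fun s =>
      Continuous.aestronglyMeasurable (by unfold dotProduct; fun_prop))
    (by simpa using ((integrableOn_orthant_exp hw).mono_set hK).integrable)
    (Continuous.aestronglyMeasurable (by unfold dotProduct; fun_prop))
    ?_ ((integrableOn_orthant_mul_exp (update_half_pos hw i) i).mono_set hK) ?_
  · simpa only [expMass, hdot, zero_mul, add_zero] using key.2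
  · refine (ae_restrict_iff' hmeas).2 (Eventually.of_forall fun x hx s hs => ?_)
    have hxi : 0 ≤ x i := hK hx i trivial
    rw [Real.norm_eq_abs, abs_of_nonneg (mul_nonneg hxi (Real.exp_pos _).le), hhalf]
    have : s * x i ≤ w i / 2 * x i := mul_le_mul_of_nonneg_right (le_of_lt hs) hxi
    gcongr
  · refine Eventually.of_forall fun x s _ => ?_
    have h1 : HasDerivAt (fun s : ℝ => -(w ⬝ᵥ x) + s * x i) (x i) s := by
      simpa using ((hasDerivAt_id s).mul_const (x i)).const_add (-(w ⬝ᵥ x))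
    simpa [mul_comm] using h1.exp

/-- A point at which the Fenchel inequality is an equality is the mean. -/
theorem eq_expMean_of_entropicBarrier_le (hK : K ⊆ orthant n) (hmeas : MeasurableSet K)
    (hne : (interior K).Nonempty) (hw : ∀ i, 0 < w i) {x : Fin n → ℝ}
    (hx : entropicBarrier K x ≤ ((-(w ⬝ᵥ x) - Real.log (expMass K w) : ℝ) : EReal)) :
    x = expMean K w := by
  have hZ := expMass_pos hK hne hw
  ext i
  rw [expMean, eq_div_iff hZ.ne']
  -- Equality at `w` and the Fenchel inequality at `w - s e_i` bound the mass below by an affine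
  -- function of `s` touching it at `0`. The derivatives there agree, and this gives the coordinate
  -- `x i` of the mean.
  have hmin : ∀ᶠ s : ℝ in 𝓝 0, expMass K w * (1 + s * x i) ≤ expMass K (w - Pi.single i s) := by
    filter_upwards [Iio_mem_nhds (hw i)] with s hs
    have hw' : ∀ j, 0 < (w - Pi.single i s : Fin n → ℝ) j := by
      intro j
      by_cases h : j = i
      · subst h; simpa using hs
      · simpa [h] using hw j
    have h1 := (le_entropicBarrier hK hne hw' x).trans hx
    rw [EReal.coe_le_coe_iff, sub_dotProduct, single_dotProduct] at h1
    have hZ' := expMass_pos hK hne hw'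
    have h2 : Real.log (expMass K w) + s * x i ≤ Real.log (expMass K (w - Pi.single i s)) := by
      linarith
    have h3 := Real.exp_le_exp.2 h2
    rw [Real.exp_add, Real.exp_log hZ, Real.exp_log hZ'] at h3
    refine le_trans (mul_le_mul_of_nonneg_left ?_ hZ.le) h3
    linarith [Real.add_one_le_exp (s * x i)]
  have hd : HasDerivAt (fun s : ℝ => expMass K (w - Pi.single i s) -
      expMass K w * (1 + s * x i)) ((∫ x in K, x i * Real.exp (-(w ⬝ᵥ x))) - expMass K w * x i) 0 := by
    refine (hasDerivAt_expMass hK hmeas hw i).sub ?_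
    simpa using (((hasDerivAt_id (0 : ℝ)).mul_const (x i)).const_add 1).const_mul (expMass K w)
  have hloc : IsLocalMin (fun s : ℝ => expMass K (w - Pi.single i s) -
      expMass K w * (1 + s * x i)) 0 := by
    filter_upwards [hmin] with s hs
    simp only [Pi.single_zero, sub_zero, zero_mul, add_zero, mul_one, sub_self]
    linarith
  have := hloc.hasDerivAt_eq_zero hd
  linarith

/-- For `w = c / μ`, the Fenchel inequality at `-w` bounds the objective below by `-μ log (expMass K
w)`, and equality holds only at the mean. -/
theorem isEntropicCentralPoint_iff (hconv : Convex ℝ K) (hK : K ⊆ orthant n)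
    (hmeas : MeasurableSet K) (hne : (interior K).Nonempty) {c : Fin n → ℝ} {μ : ℝ}
    (hc : ∀ i, 0 < c i) (hμ : 0 < μ) {x : Fin n → ℝ} :
    IsEntropicCentralPoint K c μ x ↔ x = expMean K fun i => c i / μ := by
  set w : Fin n → ℝ := fun i => c i / μ with hwdef
  have hw : ∀ i, 0 < w i := fun i => div_pos (hc i) hμ
  have hcw : ∀ y : Fin n → ℝ, ∑ i, c i * y i = μ * (w ⬝ᵥ y) := by
    intro y
    rw [dotProduct, Finset.mul_sum]
    refine Finset.sum_congr rfl fun i _ => ?_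
    rw [hwdef]
    field_simp
  set F := Real.log (expMass K w) with hF
  have hμ' : (0 : EReal) ≤ (μ : EReal) := by exact_mod_cast hμ.le
  have hcost : ∀ y : Fin n → ℝ, ((μ * (w ⬝ᵥ y) : ℝ) : EReal) +
      (μ : EReal) * ((-(w ⬝ᵥ y) - F : ℝ) : EReal) = ((-(μ * F) : ℝ) : EReal) := by
    intro y
    rw [← EReal.coe_mul, ← EReal.coe_add]
    congr 1
    ring
  have hlow : ∀ y, ((-(μ * F) : ℝ) : EReal) ≤ penalizedCost K c μ y := by
    intro y
    rw [penalizedCost, hcw, ← hcost y]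
    exact add_le_add_right (mul_le_mul_of_nonneg_left (le_entropicBarrier hK hne hw y) hμ') _
  have hmean : penalizedCost K c μ (expMean K w) = ((-(μ * F) : ℝ) : EReal) := by
    rw [penalizedCost, hcw, entropicBarrier_expMean hK hne hw, ← hcost (expMean K w)]
  have hmem := expMean_mem_interior hconv hK hmeas hne hw
  constructor
  · rintro ⟨-, hmin⟩
    refine eq_expMean_of_entropicBarrier_le hK hmeas hne hw ?_
    have h1 : penalizedCost K c μ x ≤ ((-(μ * F) : ℝ) : EReal) := hmean ▸ hmin hmem
    have h2 := le_entropicBarrier hK hne hw x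
    rw [penalizedCost, hcw] at h1
    induction hB : entropicBarrier K x with
    | bot => exact bot_le
    | top =>
      rw [hB, EReal.coe_mul_top_of_pos hμ, EReal.coe_add_top] at h1
      exact absurd h1 (not_le.2 (EReal.coe_lt_top _))
    | coe B =>
      rw [hB, ← EReal.coe_mul, ← EReal.coe_add, EReal.coe_le_coe_iff] at h1
      rw [EReal.coe_le_coe_iff]
      have : μ * (w ⬝ᵥ x + B + F) ≤ 0 := by linarith
      have := nonpos_of_mul_nonpos_right this hμ
      linarith
  · rintro rfl
    exact ⟨hmem, fun y _ => hmean ▸ hlow y⟩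

theorem entropicCentralPath_eq_expMean (hconv : Convex ℝ K) (hK : K ⊆ orthant n)
    (hmeas : MeasurableSet K) (hne : (interior K).Nonempty) {c : Fin n → ℝ} {μ : ℝ}
    (hc : ∀ i, 0 < c i) (hμ : 0 < μ) :
    entropicCentralPath K c μ = expMean K fun i => c i / μ :=
  (isEntropicCentralPoint_iff hconv hK hmeas hne hc hμ).1
    (Classical.epsilon_spec (p := IsEntropicCentralPoint K c μ)
      ⟨_, (isEntropicCentralPoint_iff hconv hK hmeas hne hc hμ).2 rfl⟩)

end Exponential

/-! ### Estimates for the mean of an exponential distribution -/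

section Estimates

variable {n : ℕ}

/-- Averaging the `n` bounds on `x i / q i` dominates the density by a product of one-dimensional
exponentials with rates of order `1 / q i`. The factor `n + 1` also covers `n = 0`. -/
theorem exp_neg_dot_le {w q x : Fin n → ℝ} (hw : ∀ i, 0 < w i) (hq : ∀ i, 0 < q i)
    (hx : ∀ i, 0 ≤ x i) (h : ∀ i, x i ≤ q i * (1 + w ⬝ᵥ x)) :
    Real.exp (-(w ⬝ᵥ x)) ≤ Real.exp 1 * Real.exp (-((fun i => ((n + 1) * q i)⁻¹) ⬝ᵥ x)) := by
  rw [← Real.exp_add, Real.exp_le_exp]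
  have hwx : 0 ≤ w ⬝ᵥ x := Finset.sum_nonneg fun i _ => mul_nonneg (hw i).le (hx i)
  have hsum : (fun i => ((n + 1) * q i)⁻¹) ⬝ᵥ x ≤ ∑ _i : Fin n, ((n : ℝ) + 1)⁻¹ * (1 + w ⬝ᵥ x) := by
    refine Finset.sum_le_sum fun i _ => ?_
    have h1 : (q i)⁻¹ * x i ≤ 1 + w ⬝ᵥ x := by
      rw [inv_mul_le_iff₀ (hq i)]
      exact h i
    change ((n + 1) * q i)⁻¹ * x i ≤ _
    rw [mul_inv, mul_assoc]
    exact mul_le_mul_of_nonneg_left h1 (by positivity)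
  rw [Finset.sum_const, Finset.card_univ, Fintype.card_fin, nsmul_eq_mul, ← mul_assoc] at hsum
  have h2 : (n : ℝ) * ((n : ℝ) + 1)⁻¹ ≤ 1 := by
    rw [← div_eq_mul_inv, div_le_one (by positivity)]
    linarith
  have h3 : (n : ℝ) * ((n : ℝ) + 1)⁻¹ * (1 + w ⬝ᵥ x) ≤ 1 * (1 + w ⬝ᵥ x) :=
    mul_le_mul_of_nonneg_right h2 (by linarith)
  linarith

variable {K : Set (Fin n → ℝ)} {w q z : Fin n → ℝ}

theorem expMass_le (hK : K ⊆ orthant n) (hmeas : MeasurableSet K) (hw : ∀ i, 0 < w i)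
    (hq : ∀ i, 0 < q i) (h : ∀ x ∈ K, ∀ i, x i ≤ q i * (1 + w ⬝ᵥ x)) :
    expMass K w ≤ Real.exp 1 * ∏ i, ((n + 1) * q i) := by
  have hr : ∀ i, 0 < ((n + 1) * q i)⁻¹ := fun i => inv_pos.2 (mul_pos (by positivity) (hq i))
  have hi := (integrableOn_orthant_exp hr).const_mul (Real.exp 1)
  calc expMass K w ≤ ∫ x in K, Real.exp 1 *
        Real.exp (-((fun i => ((n + 1) * q i)⁻¹) ⬝ᵥ x)) :=
        setIntegral_mono_on ((integrableOn_orthant_exp hw).mono_set hK) (IntegrableOn.mono_set hi hK) hmeas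
          fun x hx => exp_neg_dot_le hw hq (fun i => hK hx i trivial) (h x hx)
    _ ≤ ∫ x in orthant n, Real.exp 1 * Real.exp (-((fun i => ((n + 1) * q i)⁻¹) ⬝ᵥ x)) :=
        setIntegral_mono_set hi (Eventually.of_forall fun x => by positivity)
          (Eventually.of_forall hK)
    _ = _ := by
        rw [integral_const_mul, integral_orthant_exp hr]
        simp only [inv_inv]

theorem expMoment_le (hK : K ⊆ orthant n) (hmeas : MeasurableSet K) (hw : ∀ i, 0 < w i)
    (hq : ∀ i, 0 < q i) (h : ∀ x ∈ K, ∀ i, x i ≤ q i * (1 + w ⬝ᵥ x)) (i : Fin n) :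
    ∫ x in K, x i * Real.exp (-(w ⬝ᵥ x)) ≤
      Real.exp 1 * (2 * ((n + 1) * q i)) * ∏ j, (2 * ((n + 1) * q j)) := by
  set r : Fin n → ℝ := fun i => ((n + 1) * q i)⁻¹ with hrdef
  have hr : ∀ i, 0 < r i := fun i => inv_pos.2 (mul_pos (by positivity) (hq i))
  have hr' := update_half_pos hr i
  have hi := (integrableOn_orthant_exp hr').const_mul (Real.exp 1 * (2 / r i))
  have hri := hr i
  calc ∫ x in K, x i * Real.exp (-(w ⬝ᵥ x)) ≤ ∫ x in K, Real.exp 1 * (2 / r i) *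
        Real.exp (-(Function.update r i (r i / 2) ⬝ᵥ x)) := by
        refine setIntegral_mono_on ((integrableOn_orthant_mul_exp hw i).mono_set hK)
          (IntegrableOn.mono_set hi hK) hmeas fun x hx => ?_
        have h1 := exp_neg_dot_le hw hq (fun i => hK hx i trivial) (h x hx)
        have h2 := mul_le_mul_of_nonneg_left h1 (hK hx i trivial)
        have h3 := mul_le_mul_of_nonneg_left (mul_exp_neg_dot_le (x := x) i (hr i))
          (Real.exp_pos 1).le
        linarith
    _ ≤ ∫ x in orthant n, Real.exp 1 * (2 / r i) *
        Real.exp (-(Function.update r i (r i / 2) ⬝ᵥ x)) :=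
        setIntegral_mono_set hi (Eventually.of_forall fun x => by positivity)
          (Eventually.of_forall hK)
    _ = Real.exp 1 * (2 * ((n + 1) * q i)) * ∏ j, (Function.update r i (r i / 2) j)⁻¹ := by
        rw [integral_const_mul, integral_orthant_exp hr']
        simp only [hrdef, div_inv_eq_mul]
    _ ≤ _ := by
        have hqi := hq i
        refine mul_le_mul_of_nonneg_left (Finset.prod_le_prod
          (fun j _ => (inv_pos.2 (hr' j)).le) fun j _ => ?_) (by positivity)
        by_cases hj : j = i
        · subst hj
          simp only [Function.update_self, inv_div, hrdef, div_inv_eq_mul, le_refl]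
        · have hqj := hq j
          have : 0 < (n + 1) * q j := by positivity
          simp only [Function.update_of_ne hj, hrdef, inv_inv]
          linarith

/-- Only the box from `z` to `2 z` is kept: its volume is `∏ z i`, and `⟨w, x⟩ ≤ 2 ⟨w, z⟩ ≤ 1` on
it. It is applied to `g = 1` and to `g = x i`. -/
theorem le_expIntegral (hz : ∀ i, 0 < z i) {g : (Fin n → ℝ) → ℝ}
    (hg : ∀ x ∈ K, 0 ≤ g x) (hmeas : MeasurableSet K)
    (hi : IntegrableOn (fun x => g x * Real.exp (-(w ⬝ᵥ x))) K) (hw : ∀ i, 0 < w i)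
    (hbox : ∀ x, (∀ i, z i ≤ x i ∧ x i ≤ 2 * z i) → x ∈ K) (hwz : 2 * (w ⬝ᵥ z) ≤ 1)
    {a : ℝ} (hga : ∀ x, (∀ i, z i ≤ x i) → a ≤ g x) :
    a * Real.exp (-1) * ∏ i, z i ≤ ∫ x in K, g x * Real.exp (-(w ⬝ᵥ x)) := by
  have hsub : Set.Icc z (fun i => 2 * z i) ⊆ K :=
    fun x hx => hbox x fun i => ⟨hx.1 i, hx.2 i⟩
  have hvol : volume.real (Set.Icc z (fun i => 2 * z i)) = ∏ i, z i := by
    rw [Measure.real, Real.volume_Icc_pi_toReal fun i => by linarith [hz i]]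
    exact Finset.prod_congr rfl fun i _ => by ring
  have hfin : volume (Set.Icc z (fun i => 2 * z i)) ≠ ⊤ := isCompact_Icc.measure_lt_top.ne
  calc a * Real.exp (-1) * ∏ i, z i
      = ∫ _x in Set.Icc z (fun i => 2 * z i), a * Real.exp (-1) := by
        rw [setIntegral_const, hvol, smul_eq_mul, mul_comm]
    _ ≤ ∫ x in Set.Icc z (fun i => 2 * z i), g x * Real.exp (-(w ⬝ᵥ x)) := by
        refine setIntegral_mono_on (integrableOn_const hfin) (hi.mono_set hsub)
          measurableSet_Icc fun x hx => ?_
        have h1 : w ⬝ᵥ x ≤ 2 * (w ⬝ᵥ z) := by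
          rw [dotProduct, dotProduct, Finset.mul_sum]
          refine Finset.sum_le_sum fun i _ => ?_
          have := mul_le_mul_of_nonneg_left (hx.2 i) (hw i).le
          linarith
        exact mul_le_mul (hga x hx.1) (Real.exp_le_exp.2 (by linarith)) (Real.exp_pos _).le
          (hg x (hsub hx))
    _ ≤ _ := by
        refine setIntegral_mono_set hi ?_ (Eventually.of_forall hsub)
        exact (ae_restrict_iff' hmeas).2
          (Eventually.of_forall fun x hx => mul_nonneg (hg x hx) (Real.exp_pos _).le)

/-- Two-sided bounds for the mean of an exponential distribution on a set which contains a box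
where the density is not small and in which large coordinates force a small density. -/
theorem exists_expMean_bounds (n : ℕ) : ∃ C : ℝ, 0 < C ∧
    ∀ (K : Set (Fin n → ℝ)) (w q z : Fin n → ℝ), K ⊆ orthant n → MeasurableSet K →
      (∀ i, 0 < w i) → (∀ i, 0 < q i) → (∀ i, 0 < z i) →
      (∀ x ∈ K, ∀ i, x i ≤ q i * (1 + w ⬝ᵥ x)) →
      (∀ x, (∀ i, z i ≤ x i ∧ x i ≤ 2 * z i) → x ∈ K) → 2 * (w ⬝ᵥ z) ≤ 1 →
      ∀ i, C⁻¹ * (z i * ∏ j, z j / q j) ≤ expMean K w i ∧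
        expMean K w i ≤ C * (q i * ∏ j, q j / z j) := by
  set N : ℝ := n + 1 with hN
  have hNpos : 1 ≤ N := by rw [hN]; linarith [n.cast_nonneg (α := ℝ)]
  -- One factor `e` comes from the upper integral bounds and one from the lower ones; `(2 * N) ^ (n
  -- + 1)` comes from the upper bound on the first moment.
  refine ⟨Real.exp 2 * (2 * N) ^ (n + 1), by positivity, ?_⟩
  intro K w q z hK hmeas hw hq hz hup hbox hwz i
  have hmass1 := expMass_le hK hmeas hw hq hup
  have hmom1 := expMoment_le hK hmeas hw hq hup i
  have hmass2 : 1 * Real.exp (-1) * ∏ i, z i ≤ expMass K w := by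
    simpa [expMass] using le_expIntegral (g := fun _ => 1) (a := 1) hz (fun _ _ => zero_le_one)
      hmeas (by simpa using (integrableOn_orthant_exp hw).mono_set hK) hw hbox hwz
      (fun _ _ => le_rfl)
  have hmom2 := le_expIntegral (g := fun x => x i) (a := z i) hz (fun x hx => hK hx i trivial)
    hmeas ((integrableOn_orthant_mul_exp hw i).mono_set hK) hw hbox hwz (fun x hx => hx i)
  have hPz : 0 < ∏ j, z j := Finset.prod_pos fun j _ => hz j
  have hPq : 0 < ∏ j, q j := Finset.prod_pos fun j _ => hq j
  have hqi := hq i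
  have hzi := hz i
  have hM : 0 < expMass K w := lt_of_lt_of_le (by positivity) hmass2
  have he : Real.exp 2 = Real.exp 1 * Real.exp 1 := by rw [← Real.exp_add]; norm_num
  have hprod : ∀ a : ℝ, ∏ j, (a * q j) = a ^ n * ∏ j, q j := fun a => by
    rw [Finset.prod_mul_distrib, Finset.prod_const, Finset.card_univ, Fintype.card_fin]
  rw [hprod] at hmass1
  simp only [← mul_assoc] at hmom1
  rw [hprod] at hmom1
  simp only [Finset.prod_div_distrib]
  unfold expMean
  constructor
  · rw [le_div_iff₀ hM]
    refine le_trans ?_ hmom2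
    have h2N : N ^ n ≤ (2 * N) ^ (n + 1) := by
      calc N ^ n ≤ (2 * N) ^ n := pow_le_pow_left₀ (by linarith) (by linarith) n
        _ ≤ (2 * N) ^ (n + 1) := pow_le_pow_right₀ (by linarith) (Nat.le_succ n)
    calc (Real.exp 2 * (2 * N) ^ (n + 1))⁻¹ * (z i * ((∏ j, z j) / ∏ j, q j)) * expMass K w
        ≤ (Real.exp 2 * (2 * N) ^ (n + 1))⁻¹ * (z i * ((∏ j, z j) / ∏ j, q j)) *
          (Real.exp 1 * ((2 * N) ^ (n + 1) * ∏ j, q j)) := by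
          refine mul_le_mul_of_nonneg_left (hmass1.trans ?_) (by positivity)
          gcongr
      _ = z i * Real.exp (-1) * ∏ j, z j := by
          rw [he, Real.exp_neg]
          field_simp
  · rw [div_le_iff₀ hM]
    refine hmom1.trans ?_
    calc Real.exp 1 * 2 * N * q i * ((2 * N) ^ n * ∏ j, q j)
        = Real.exp 2 * (2 * N) ^ (n + 1) * (q i * ((∏ j, q j) / ∏ j, z j)) *
          (1 * Real.exp (-1) * ∏ j, z j) := by
          rw [he, Real.exp_neg]
          field_simp
          ring
      _ ≤ _ := mul_le_mul_of_nonneg_left hmass2 (by positivity)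

end Estimates

theorem tendsto_logb_of_rpow_bounds {f : ℝ → ℝ} {a : ℝ}
    (h : ∀ ε > 0, ∀ᶠ t : ℝ in atTop, t ^ (a - ε) ≤ f t ∧ f t ≤ t ^ (a + ε)) :
    Tendsto (fun t => Real.logb t (f t)) atTop (𝓝 a) := by
  rw [Metric.tendsto_nhds]
  intro ε hε
  filter_upwards [h (ε / 2) (half_pos hε), eventually_gt_atTop 1] with t ht h1
  have h0 : 0 < t := by linarith
  have hf : 0 < f t := (Real.rpow_pos_of_pos h0 _).trans_le ht.1
  have l1 := (Real.le_logb_iff_rpow_le h1 hf).2 ht.1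
  have l2 := (Real.logb_le_iff_le_rpow h1 hf).2 ht.2
  rw [Real.dist_eq, abs_lt]
  constructor <;> linarith

section CentralPath

open Puiseux

variable {m n : ℕ} {A : Matrix (Fin m) (Fin n) Puiseux} {b : Fin m → Puiseux}

/-! ### The polyhedra `P(t)` -/

theorem convex_polyhedronAt (A : Matrix (Fin m) (Fin n) Puiseux) (b : Fin m → Puiseux) (t : ℝ) :
    Convex ℝ (polyhedronAt A b t) := by
  intro x hx y hy r s hr hs hrs i
  calc ∑ j, (A i j).eval t * (r • x + s • y) j
      = r * ∑ j, (A i j).eval t * x j + s * ∑ j, (A i j).eval t * y j := by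
        rw [Finset.mul_sum, Finset.mul_sum, ← Finset.sum_add_distrib]
        refine Finset.sum_congr rfl fun j _ => ?_
        simp only [Pi.add_apply, Pi.smul_apply, smul_eq_mul]
        ring
    _ ≤ r * (b i).eval t + s * (b i).eval t :=
        add_le_add (mul_le_mul_of_nonneg_left (hx i) hr) (mul_le_mul_of_nonneg_left (hy i) hs)
    _ = (b i).eval t := by rw [← add_mul, hrs, one_mul]

theorem isClosed_polyhedronAt (A : Matrix (Fin m) (Fin n) Puiseux) (b : Fin m → Puiseux)
    (t : ℝ) : IsClosed (polyhedronAt A b t) := by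
  have : polyhedronAt A b t = ⋂ i, {x | ∑ j, (A i j).eval t * x j ≤ (b i).eval t} := by
    ext x
    simp [polyhedronAt]
  rw [this]
  exact isClosed_iInter fun i => isClosed_le (by fun_prop) continuous_const

theorem eventually_polyhedronAt_subset_orthant (hnonneg : ∀ x ∈ polyhedron A b, ∀ i, 0 ≤ x i)
    (hzero : (0 : Fin n → Puiseux) ∈ polyhedron A b) :
    ∀ᶠ t : ℝ in atTop, polyhedronAt A b t ⊆ orthant n := by
  obtain ⟨G, hG, hev⟩ := exists_polyhedron_generators A b
  have e1 : ∀ᶠ t : ℝ in atTop, ∀ g ∈ G, ∀ o, 0 ≤ (g o).eval t :=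
    (eventually_all_finset G).2 fun g hg => eventually_all.2 fun o =>
      eventually_eval_nonneg (homogCone_nonneg hnonneg hzero (hG g hg).1 o)
  filter_upwards [hev, e1] with t h1 h2 x hx i _
  exact h1 x hx (LinearMap.proj (some i)) fun g hg => h2 g hg (some i)

/-- If `x ≤ x*` for all `x` in the tropicalization of a bounded section of the polyhedron, then
`t^(x* + ε)` bounds the section of `P(t)` for large `t`. -/
theorem eventually_section_le (hnonneg : ∀ x ∈ polyhedron A b, ∀ i, 0 ≤ x i)
    (hzero : (0 : Fin n → Puiseux) ∈ polyhedron A b) {c : Fin n → Puiseux}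
    (hc : ∀ i, 0 < c i) {μ : Puiseux} (hμ : 0 < μ) {xs : Fin n → ℝ}
    (hxs : ∀ x ∈ polyhedron A b, ∑ j, c j * x j ≤ μ → ∀ i, (x i).val ≤ xs i)
    {ε : ℝ} (hε : 0 < ε) :
    ∀ᶠ t : ℝ in atTop, ∀ x ∈ polyhedronAt A b t,
      ∑ j, (c j).eval t * x j ≤ μ.eval t → ∀ i, x i ≤ t ^ (xs i + ε) := by
  -- The cost constraint becomes row `0` of an enlarged system.
  let A' : Matrix (Fin (m + 1)) (Fin n) Puiseux := Fin.cons c A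
  let b' : Fin (m + 1) → Puiseux := Fin.cons μ b
  have hA' : ∀ x, x ∈ polyhedron A' b' ↔ ∑ j, c j * x j ≤ μ ∧ x ∈ polyhedron A b := fun x =>
    Fin.forall_fin_succ
  have hA't : ∀ t x, x ∈ polyhedronAt A' b' t ↔
      ∑ j, (c j).eval t * x j ≤ μ.eval t ∧ x ∈ polyhedronAt A b t := fun t x =>
    Fin.forall_fin_succ
  have hzero' : (0 : Fin n → Puiseux) ∈ polyhedron A' b' :=
    (hA' 0).2 ⟨by simpa using hμ.le, hzero⟩
  have hnonneg' : ∀ x ∈ polyhedron A' b', ∀ i, 0 ≤ x i := fun x hx =>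
    hnonneg x ((hA' x).1 hx).2
  obtain ⟨G, hG, hev⟩ := exists_polyhedron_generators A' b'
  have hlt : ∀ g ∈ G, ∀ i, g (some i) ≤ monomial 1 (xs i + ε) * g none := by
    intro g hg i
    obtain ⟨hgc, hg0⟩ := hG g hg
    have hgnn := homogCone_nonneg hnonneg' hzero' hgc
    have hpos : 0 < g none := by
      -- The section has no recession direction: `⟨c, g⟩ ≤ 0` with `c > 0` and `g ≥ 0` forces `g =
      -- 0`.
      refine lt_of_le_of_ne hgc.1 fun h0 => hg0 ?_
      have hsum : ∑ j, c j * g (some j) ≤ 0 := by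
        have := hgc.2 0
        rw [← h0, mul_zero] at this
        exact this
      have hnn : ∀ j ∈ Finset.univ, 0 ≤ c j * g (some j) := fun j _ =>
        mul_nonneg (hc j).le (hgnn _)
      have hz := (Finset.sum_eq_zero_iff_of_nonneg hnn).1
        (le_antisymm hsum (Finset.sum_nonneg hnn))
      ext1 o
      cases o with
      | none => exact h0.symm
      | some j => exact (mul_eq_zero.1 (hz j (Finset.mem_univ j))).resolve_left (hc j).ne'
    obtain ⟨x, hx, hxv⟩ := exists_mem_polyhedron_val hzero' hgc hpos
    obtain ⟨hx1, hx2⟩ := (hA' x).1 hx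
    refine (lt_of_val_lt (mul_pos (monomial_pos one_pos _) hpos) ?_).le
    rw [val_mul, val_monomial one_ne_zero, ← hxv i]
    obtain ⟨v, hv⟩ := exists_val_eq hpos.ne'
    rw [hv]
    refine WithBot.add_lt_add_right WithBot.coe_ne_bot ((hxs x hx2 hx1 i).trans_lt ?_)
    exact_mod_cast lt_add_of_pos_right _ hε
  have e1 : ∀ᶠ t : ℝ in atTop, ∀ g ∈ G, ∀ i,
      (g (some i)).eval t ≤ t ^ (xs i + ε) * (g none).eval t :=
    (eventually_all_finset G).2 fun g hg => eventually_all.2 fun i => by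
      filter_upwards [eventually_eval_le (hlt g hg i),
        eventually_eval_mul (monomial 1 (xs i + ε)) (g none)] with t h1 h2
      rwa [h2, eval_monomial, one_mul] at h1
  filter_upwards [hev, e1] with t h1 h2 x hx hcx i
  have := h1 x ((hA't t x).2 ⟨hcx, hx⟩)
    (t ^ (xs i + ε) • LinearMap.proj none - LinearMap.proj (some i)) fun g hg => by
      simpa [evalVec] using h2 g hg i
  simpa [homog] using this

/-- Division by `1 + ⟨w, x⟩ ≥ 1` keeps `x` in `P(t)`, since `b(t) ≥ 0`, and brings its cost below
`μ(t)`, where the bound on the section applies. -/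
theorem eventually_le_mul_one_add (hnonneg : ∀ x ∈ polyhedron A b, ∀ i, 0 ≤ x i)
    (hzero : (0 : Fin n → Puiseux) ∈ polyhedron A b) {c : Fin n → Puiseux}
    (hc : ∀ i, 0 < c i) {μ : Puiseux} (hμ : 0 < μ) {xs : Fin n → ℝ}
    (hxs : ∀ x ∈ polyhedron A b, ∑ j, c j * x j ≤ μ → ∀ i, (x i).val ≤ xs i)
    {ε : ℝ} (hε : 0 < ε) :
    ∀ᶠ t : ℝ in atTop, ∀ x ∈ polyhedronAt A b t, ∀ i, x i ≤ t ^ (xs i + ε) *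
      (1 + (fun j => (c j).eval t / μ.eval t) ⬝ᵥ x) := by
  have eb : ∀ᶠ t : ℝ in atTop, ∀ i, 0 ≤ (b i).eval t := eventually_all.2 fun i =>
    eventually_eval_nonneg (nonneg_of_zero_mem_polyhedron hzero i)
  have ec : ∀ᶠ t : ℝ in atTop, ∀ i, 0 < (c i).eval t := eventually_all.2 fun i =>
    eventually_eval_pos (hc i)
  filter_upwards [eventually_section_le hnonneg hzero hc hμ hxs hε, eb, ec,
    eventually_eval_pos hμ, eventually_polyhedronAt_subset_orthant hnonneg hzero]
    with t h hb hct hμt hK x hx i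
  set w : Fin n → ℝ := fun j => (c j).eval t / μ.eval t with hw
  have hwx : 0 ≤ w ⬝ᵥ x := Finset.sum_nonneg fun j _ =>
    mul_nonneg (div_pos (hct j) hμt).le (hK hx j trivial)
  set s := 1 + w ⬝ᵥ x with hs
  have hs1 : 1 ≤ s := by linarith
  have hs0 : 0 < s := by linarith
  have hcw : ∑ j, (c j).eval t * x j = μ.eval t * (w ⬝ᵥ x) := by
    rw [dotProduct, Finset.mul_sum]
    refine Finset.sum_congr rfl fun j _ => ?_
    rw [hw]
    field_simp
  have hscale : ∀ a : Fin n → ℝ, ∑ j, a j * (s⁻¹ * x j) = s⁻¹ * ∑ j, a j * x j := fun a => by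
    rw [Finset.mul_sum]
    exact Finset.sum_congr rfl fun j _ => by ring
  have h1 := h (fun j => s⁻¹ * x j) (fun k => ?_) ?_ i
  · rwa [inv_mul_le_iff₀ hs0, mul_comm] at h1
  · rw [hscale, inv_mul_le_iff₀ hs0]
    refine (hx k).trans ?_
    nlinarith [hb k]
  · rw [hscale, hcw, inv_mul_le_iff₀ hs0, mul_comm s]
    exact mul_le_mul_of_nonneg_left (by linarith) hμt.le

/-- Near the exponential of a real interior point of `val P`, shifted downwards, `P(t)` contains
a full box for large `t`. -/
theorem eventually_box_subset_polyhedronAt (hnonneg : ∀ x ∈ polyhedron A b, ∀ i, 0 ≤ x i)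
    (hzero : (0 : Fin n → Puiseux) ∈ polyhedron A b) {y : Fin n → ℝ}
    (hy : (fun j => (y j : Trop)) ∈ interior (valImage (polyhedron A b))) {s : ℝ} (hs : 0 ≤ s) :
    ∀ᶠ t : ℝ in atTop, ∀ x : Fin n → ℝ,
      (∀ j, t ^ (y j - s) ≤ x j ∧ x j ≤ 2 * t ^ (y j - s)) → x ∈ polyhedronAt A b t := by
  classical
  suffices h : ∀ i, ∀ᶠ t : ℝ in atTop, ∀ x : Fin n → ℝ,
      (∀ j, t ^ (y j - s) ≤ x j ∧ x j ≤ 2 * t ^ (y j - s)) →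
        ∑ j, (A i j).eval t * x j ≤ (b i).eval t by
    filter_upwards [eventually_all.2 h] with t ht x hx i
    exact ht i x hx
  intro i
  -- For row `i`, the interior point is raised only in the coordinates with a positive entry. The
  -- lift `x'` of the raised point leaves room in row `i` for every other choice of leading
  -- coefficients.
  obtain ⟨ε, hmem, hε⟩ : ∃ ε : ℝ, (fun j => ((y j + if 0 < A i j then ε else 0 : ℝ) : Trop)) ∈
      valImage (polyhedron A b) ∧ 0 < ε := by
    have hcont : Continuous fun ε : ℝ =>
        (fun j => ((y j + if 0 < A i j then ε else 0 : ℝ) : Trop)) := by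
      refine continuous_pi fun j => WithBot.continuous_coe.comp ?_
      by_cases h : 0 < A i j <;> simp only [h, if_true, if_false] <;> fun_prop
    have h0 : ∀ᶠ ε : ℝ in 𝓝 0, (fun j => ((y j + if 0 < A i j then ε else 0 : ℝ) : Trop)) ∈
        valImage (polyhedron A b) := by
      refine hcont.continuousAt.eventually (mem_interior_iff_mem_nhds.1 ?_)
      simpa using hy
    have h1 : ∀ᶠ ε : ℝ in 𝓝[>] 0, (fun j => ((y j + if 0 < A i j then ε else 0 : ℝ) : Trop)) ∈
        valImage (polyhedron A b) := nhdsWithin_le_nhds h0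
    exact (h1.and self_mem_nhdsWithin).exists
  obtain ⟨x', hx', hval⟩ := hmem
  have hval' : ∀ j, (x' j).val = ((y j + if 0 < A i j then ε else 0 : ℝ) : Trop) :=
    fun j => congrFun hval j
  -- The corner of the box that is worst for row `i`: the upper end where the entry is positive, the
  -- lower end elsewhere.
  let κ : Fin n → ℝ := fun j => if 0 < A i j then 2 else 1
  have hκ : ∀ j, 0 < κ j := fun j => by
    by_cases h : 0 < A i j <;> simp [κ, h]
  have hterm : ∀ j, A i j * monomial (κ j) (y j + ε / 2) ≤ A i j * x' j := by
    intro j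
    by_cases h : 0 < A i j
    · refine mul_le_mul_of_nonneg_left (lt_of_val_lt ?_ ?_).le h.le
      · refine lt_of_le_of_ne (hnonneg x' hx' j) (Ne.symm fun h0 => ?_)
        have := hval' j
        rw [h0, val_zero] at this
        exact WithBot.bot_ne_coe this
      · rw [val_monomial (hκ j).ne', hval', if_pos h]
        exact_mod_cast (by linarith : y j + ε / 2 < y j + ε)
    · refine mul_le_mul_of_nonpos_left (lt_of_val_lt (monomial_pos (hκ j) _) ?_).le (not_lt.1 h)
      rw [val_monomial (hκ j).ne', hval', if_neg h]
      exact_mod_cast (by linarith : y j + 0 < y j + ε / 2)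
  -- Multiplication by this monomial moves the exponents from `y + ε / 2` to `y - s`; as it is at
  -- most `1` and `b i ≥ 0`, the row inequality survives.
  have hmono : monomial 1 (-(ε / 2) - s) ≤ 1 := by
    refine (lt_of_val_lt one_pos ?_).le
    rw [val_monomial one_ne_zero, ← monomial_one_zero, val_monomial one_ne_zero]
    exact_mod_cast (by linarith : -(ε / 2) - s < 0)
  have hrow : ∑ j, A i j * monomial (κ j) (y j - s) ≤ b i := by
    have h1 : ∑ j, A i j * monomial (κ j) (y j + ε / 2) ≤ b i :=
      (Finset.sum_le_sum fun j _ => hterm j).trans (hx' i)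
    have h2 := mul_le_mul_of_nonneg_left h1 (monomial_pos one_pos (-(ε / 2) - s)).le
    have h3 := mul_le_mul_of_nonneg_right hmono (nonneg_of_zero_mem_polyhedron hzero i)
    rw [one_mul] at h3
    refine (le_of_eq ?_).trans (h2.trans h3)
    rw [Finset.mul_sum]
    refine Finset.sum_congr rfl fun j _ => ?_
    rw [mul_left_comm, monomial_mul, one_mul]
    congr 2
    ring
  have esign : ∀ᶠ t : ℝ in atTop, ∀ j, (0 < A i j → 0 ≤ (A i j).eval t) ∧
      (¬ 0 < A i j → (A i j).eval t ≤ 0) := by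
    refine eventually_all.2 fun j => ?_
    by_cases h : 0 < A i j
    · filter_upwards [eventually_eval_pos h] with t ht
      exact ⟨fun _ => ht.le, fun h' => absurd h h'⟩
    · filter_upwards [eventually_eval_le (not_lt.1 h)] with t ht
      rw [eval_zero] at ht
      exact ⟨fun h' => absurd h' h, fun _ => ht⟩
  filter_upwards [eventually_eval_le hrow,
    eventually_eval_dot (A i) fun j => monomial (κ j) (y j - s), esign] with t h1 h2 h3 x hx
  rw [h2] at h1
  refine le_trans (Finset.sum_le_sum fun j _ => ?_) h1
  rw [eval_monomial]
  by_cases h : 0 < A i j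
  · simp only [κ, if_pos h]
    exact mul_le_mul_of_nonneg_left (hx j).2 ((h3 j).1 h)
  · simp only [κ, if_neg h, one_mul]
    exact mul_le_mul_of_nonpos_left (hx j).1 ((h3 j).2 h)

/-! ### The tropical barycenter -/

theorem tropDot_le_iff {a x : Fin n → Trop} {r : Trop} :
    tropDot a x ≤ r ↔ ∀ j, a j + x j ≤ r := by
  simp [tropDot, Finset.sup_le_iff]

theorem isCompact_section (hclosed : IsClosed (valImage (polyhedron A b))) {c : Fin n → Puiseux}
    (hc : ∀ i, 0 < c i) {μ : Puiseux} (hμ : 0 < μ) :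
    IsCompact {x ∈ valImage (polyhedron A b) | tropDot (fun i => (c i).val) x ≤ μ.val} := by
  choose γ hγ using fun i => exists_val_eq (hc i).ne'
  obtain ⟨r, hr⟩ := exists_val_eq hμ.ne'
  -- As all `c i` are nonzero, the cost bound cuts out an order interval of `𝕋ⁿ`, which is compact.
  have : {x ∈ valImage (polyhedron A b) | tropDot (fun i => (c i).val) x ≤ μ.val} =
      valImage (polyhedron A b) ∩ Set.Icc ⊥ (fun i => ((r - γ i : ℝ) : Trop)) := by
    ext x
    refine and_congr_right fun _ => ?_
    rw [tropDot_le_iff, Set.mem_Icc, and_iff_right bot_le, Pi.le_def]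
    refine forall_congr' fun i => ?_
    rw [hγ, hr]
    induction x i using WithBot.recBotCoe with
    | bot => simp
    | coe v =>
      rw [← WithBot.coe_add, WithBot.coe_le_coe, WithBot.coe_le_coe, le_sub_iff_add_le']
  rw [this]
  exact isCompact_Icc.inter_left hclosed

/-- The midpoint of two nonnegative lifts lies in `P`, and its valuation is the entrywise maximum.
-/
theorem sup_mem_valImage (hnonneg : ∀ x ∈ polyhedron A b, ∀ i, 0 ≤ x i) {x y : Fin n → Trop}
    (hx : x ∈ valImage (polyhedron A b)) (hy : y ∈ valImage (polyhedron A b)) :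
    x ⊔ y ∈ valImage (polyhedron A b) := by
  obtain ⟨p, hp, rfl⟩ := hx
  obtain ⟨q, hq, rfl⟩ := hy
  have hhalf : (0 : Puiseux) ≤ monomial (1 / 2) 0 := (monomial_pos (by norm_num) 0).le
  have hone : monomial (1 / 2) 0 + monomial (1 / 2) 0 = 1 := by
    rw [monomial_add, ← monomial_one_zero]
    norm_num
  refine ⟨fun j => monomial (1 / 2) 0 * (p j + q j), fun i => ?_, funext fun j => ?_⟩
  · calc ∑ j, A i j * (monomial (1 / 2) 0 * (p j + q j))
        = monomial (1 / 2) 0 * ∑ j, A i j * p j + monomial (1 / 2) 0 * ∑ j, A i j * q j := by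
          rw [Finset.mul_sum, Finset.mul_sum, ← Finset.sum_add_distrib]
          exact Finset.sum_congr rfl fun j _ => by ring
      _ ≤ monomial (1 / 2) 0 * b i + monomial (1 / 2) 0 * b i :=
          add_le_add (mul_le_mul_of_nonneg_left (hp i) hhalf)
            (mul_le_mul_of_nonneg_left (hq i) hhalf)
      _ = b i := by rw [← add_mul, hone, one_mul]
  · have hpj := hnonneg p hp j
    have hqj := hnonneg q hq j
    change (monomial (1 / 2) 0 * (p j + q j)).val = (p j).val ⊔ (q j).val
    rw [val_mul, val_monomial (by norm_num)]
    refine (zero_add _).trans (le_antisymm (val_add_le _ _) (sup_le ?_ ?_))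
    · exact val_mono hpj (le_add_of_nonneg_right hqj)
    · exact val_mono hqj (le_add_of_nonneg_left hpj)

/-- Infinite coordinates of a point of `U` are replaced by a real number tending to `-∞`. -/
theorem exists_real_mem_of_isOpen {U : Set (Fin n → Trop)} (hU : IsOpen U) (hne : U.Nonempty) :
    ∃ y : Fin n → ℝ, (fun j => (y j : Trop)) ∈ U := by
  classical
  obtain ⟨x, hx⟩ := hne
  have hlim : Tendsto (fun (r : ℝ) (j : Fin n) =>
      ((if x j = ⊥ then r else (x j).unbotD 0 : ℝ) : Trop)) atBot (𝓝 x) := by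
    refine tendsto_pi_nhds.2 fun j => ?_
    by_cases h : x j = ⊥
    · simp only [h, if_true]
      refine (WithBot.tendsto_nhds_bot_iff _).2 fun i => ?_
      filter_upwards [eventually_lt_atBot i] with r hr
      exact_mod_cast hr
    · obtain ⟨v, hv⟩ := WithBot.ne_bot_iff_exists.1 h
      simp [← hv]
  obtain ⟨r, hr⟩ := (hlim.eventually (hU.mem_nhds hx)).exists
  exact ⟨_, hr⟩

/-- Compactness gives a maximizer of each coordinate, and the supremum of these stays in the
section. Its coordinates are finite because the section contains a real point, obtained by shifting
a real interior point of `val P` downwards. -/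
theorem exists_real_isGreatest (hnonneg : ∀ x ∈ polyhedron A b, ∀ i, 0 ≤ x i)
    (hzero : (0 : Fin n → Puiseux) ∈ polyhedron A b)
    (hregular : valImage (polyhedron A b) = closure (interior (valImage (polyhedron A b))))
    {c : Fin n → Puiseux} (hc : ∀ i, 0 < c i) {μ : Puiseux} (hμ : 0 < μ) :
    ∃ xs : Fin n → ℝ, IsGreatest
      {x ∈ valImage (polyhedron A b) | tropDot (fun i => (c i).val) x ≤ μ.val}
      (fun i => (xs i : Trop)) := by
  set S := {x ∈ valImage (polyhedron A b) | tropDot (fun i => (c i).val) x ≤ μ.val} with hS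
  have hclosed : IsClosed (valImage (polyhedron A b)) := hregular ▸ isClosed_closure
  have hcomp : IsCompact S := isCompact_section hclosed hc hμ
  have hbot : (⊥ : Fin n → Trop) ∈ S := by
    refine ⟨⟨0, hzero, funext fun j => val_zero⟩, tropDot_le_iff.2 fun j => ?_⟩
    simp
  have hsup : ∀ x ∈ S, ∀ y ∈ S, x ⊔ y ∈ S := by
    intro x hx y hy
    refine ⟨sup_mem_valImage hnonneg hx.1 hy.1, tropDot_le_iff.2 fun j => ?_⟩
    have h1 := tropDot_le_iff.1 hx.2 j
    have h2 := tropDot_le_iff.1 hy.2 j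
    rcases le_total (x j) (y j) with h | h
    · rwa [Pi.sup_apply, sup_of_le_right h]
    · rwa [Pi.sup_apply, sup_of_le_left h]
  have hmax : ∀ i : Fin n, ∃ s ∈ S, ∀ x ∈ S, x i ≤ s i := fun i =>
    hcomp.exists_isMaxOn ⟨⊥, hbot⟩ (continuous_apply i).continuousOn
  choose s hsS hsmax using hmax
  have hgS : Finset.univ.sup s ∈ S := Finset.sup_mem S hbot hsup Finset.univ s fun i _ => hsS i
  have hgr : IsGreatest S (Finset.univ.sup s) := by
    refine ⟨hgS, fun x hx i => (hsmax i x hx).trans ?_⟩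
    exact (Finset.le_sup (f := s) (Finset.mem_univ i) : s i ≤ Finset.univ.sup s) i
  have hne : (interior (valImage (polyhedron A b))).Nonempty := by
    rw [← closure_nonempty_iff, ← hregular]
    exact ⟨⊥, hbot.1⟩
  obtain ⟨y, hy⟩ := exists_real_mem_of_isOpen isOpen_interior hne
  obtain ⟨p, hp, hpy⟩ := interior_subset hy
  choose γ hγ using fun i => exists_val_eq (hc i).ne'
  obtain ⟨r, hr⟩ := exists_val_eq hμ.ne'
  obtain ⟨M, hM0, hM⟩ : ∃ M : ℝ, 0 ≤ M ∧ ∀ j, γ j + y j - r ≤ M := by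
    refine ⟨∑ j, |γ j + y j - r|, Finset.sum_nonneg fun j _ => abs_nonneg _, fun j => ?_⟩
    exact (le_abs_self _).trans (Finset.single_le_sum (f := fun j => |γ j + y j - r|)
      (fun j _ => abs_nonneg _) (Finset.mem_univ j))
  have hmem : (fun j => ((y j - M : ℝ) : Trop)) ∈ S := by
    refine ⟨⟨_, smul_mem_polyhedron hzero (homog_mem_homogCone hp)
      (monomial_pos one_pos (-M)).le ?_, funext fun j => ?_⟩, tropDot_le_iff.2 fun j => ?_⟩
    · change monomial 1 (-M) * 1 ≤ 1
      rw [mul_one, ← sub_nonneg]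
      rcases hM0.eq_or_lt with h | h
      · rw [← h, neg_zero, monomial_one_zero, sub_self]
      · refine sub_nonneg.2 (lt_of_val_lt one_pos ?_).le
        rw [val_monomial one_ne_zero, ← monomial_one_zero, val_monomial one_ne_zero]
        exact_mod_cast neg_lt_zero.2 h
    · change (monomial 1 (-M) * p j).val = _
      have : (p j).val = y j := congrFun hpy j
      rw [val_mul, val_monomial one_ne_zero, this, ← WithBot.coe_add]
      congr 1
      ring
    · rw [hγ, hr]
      have := hM j
      exact_mod_cast (by linarith : γ j + (y j - M) ≤ r)
  have hreal : ∀ i, ∃ v : ℝ, (v : Trop) = Finset.univ.sup s i := fun i =>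
    WithBot.ne_bot_iff_exists.1
      (ne_bot_of_le_ne_bot WithBot.coe_ne_bot (hgr.2 hmem i))
  choose xs hxs using hreal
  refine ⟨xs, ?_⟩
  rwa [funext hxs]

/-! ### Asymptotics of the central path -/

/-- Real points of the interior of a regular set approximate its real points. -/
theorem exists_real_mem_interior_near {V : Set (Fin n → Trop)} {xs : Fin n → ℝ}
    (hxs : (fun i => (xs i : Trop)) ∈ closure (interior V)) {ε : ℝ} (hε : 0 < ε) :
    ∃ y : Fin n → ℝ, (fun j => (y j : Trop)) ∈ interior V ∧ ∀ j, |y j - xs j| < ε := by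
  have hopen : IsOpen (Set.pi Set.univ fun j : Fin n =>
      Set.Ioo ((xs j - ε : ℝ) : Trop) ((xs j + ε : ℝ) : Trop)) :=
    isOpen_set_pi Set.finite_univ fun j _ => isOpen_Ioo
  obtain ⟨x, hx, hxV⟩ := mem_closure_iff.1 hxs _ hopen fun j _ =>
    ⟨by exact_mod_cast sub_lt_self _ hε, by exact_mod_cast lt_add_of_pos_right _ hε⟩
  have hreal : ∀ j, ∃ v : ℝ, (v : Trop) = x j := fun j =>
    WithBot.ne_bot_iff_exists.1 (hx j trivial).1.ne_bot
  choose y hy using hreal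
  refine ⟨y, by rwa [funext hy], fun j => ?_⟩
  obtain ⟨h1, h2⟩ := hx j trivial
  rw [← hy j, WithBot.coe_lt_coe] at h1 h2
  rw [abs_lt]
  constructor <;> linarith

theorem eventually_interior_nonempty (hnonneg : ∀ x ∈ polyhedron A b, ∀ i, 0 ≤ x i)
    (hzero : (0 : Fin n → Puiseux) ∈ polyhedron A b) {y : Fin n → ℝ}
    (hy : (fun j => (y j : Trop)) ∈ interior (valImage (polyhedron A b))) :
    ∀ᶠ t : ℝ in atTop, (interior (polyhedronAt A b t)).Nonempty := by
  filter_upwards [eventually_box_subset_polyhedronAt hnonneg hzero hy le_rfl,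
    eventually_gt_atTop 0] with t ht h0
  refine ⟨fun j => 3 / 2 * t ^ (y j), mem_interior.2 ⟨Set.pi Set.univ fun j =>
    Set.Ioo (t ^ (y j)) (2 * t ^ (y j)), fun x hx => ht x fun j => ?_,
    isOpen_set_pi Set.finite_univ fun j _ => isOpen_Ioo, fun j _ => ?_⟩⟩
  · rw [sub_zero]
    exact ⟨(hx j trivial).1.le, (hx j trivial).2.le⟩
  · have := Real.rpow_pos_of_pos h0 (y j)
    constructor <;> linarith

/-- The integral estimates apply with `q = t^(x* + ε)` and `z = t^(y - ε)`, where `y` is within `ε`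
of `x*`: each ratio `q j / z j` is at most `t^(3 ε)`. -/
theorem eventually_rpow_bounds_expMean (hnonneg : ∀ x ∈ polyhedron A b, ∀ i, 0 ≤ x i)
    (hzero : (0 : Fin n → Puiseux) ∈ polyhedron A b)
    (hregular : valImage (polyhedron A b) = closure (interior (valImage (polyhedron A b))))
    {c : Fin n → Puiseux} (hc : ∀ i, 0 < c i) {μ : Puiseux} (hμ : 0 < μ) {xs : Fin n → ℝ}
    (hxs : IsGreatest {x ∈ valImage (polyhedron A b) | tropDot (fun i => (c i).val) x ≤ μ.val}
      (fun i => (xs i : Trop))) (i : Fin n) {δ : ℝ} (hδ : 0 < δ) :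
    ∀ᶠ t : ℝ in atTop,
      t ^ (xs i - δ) ≤ expMean (polyhedronAt A b t) (fun j => (c j).eval t / μ.eval t) i ∧
      expMean (polyhedronAt A b t) (fun j => (c j).eval t / μ.eval t) i ≤ t ^ (xs i + δ) := by
  obtain ⟨C, hC, hbounds⟩ := exists_expMean_bounds n
  -- The total loss in the exponent is at most `2 ε + 3 n ε`; strict inequality leaves a positive
  -- power of `t` to absorb `C`.
  obtain ⟨ε, hε, hεδ⟩ : ∃ ε : ℝ, 0 < ε ∧ 2 * ε + n * (3 * ε) < δ := by
    refine ⟨δ / (2 * (2 + 3 * n)), by positivity, ?_⟩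
    have : 2 * (δ / (2 * (2 + 3 * n))) + n * (3 * (δ / (2 * (2 + 3 * n)))) = δ / 2 := by
      field_simp
    linarith
  obtain ⟨y, hy, hyx⟩ := exists_real_mem_interior_near (hregular ▸ hxs.1.1) hε
  have hub : ∀ x ∈ polyhedron A b, ∑ j, c j * x j ≤ μ → ∀ i, (x i).val ≤ xs i := by
    intro x hx hcx
    refine hxs.2 ⟨⟨x, hx, rfl⟩, ?_⟩
    have hnn : ∀ j ∈ Finset.univ, 0 ≤ c j * x j := fun j _ =>
      mul_nonneg (hc j).le (hnonneg x hx j)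
    have h1 := val_mono (Finset.sum_nonneg hnn) hcx
    rw [val_sum_of_nonneg _ _ hnn] at h1
    simpa only [tropDot, val_mul] using h1
  -- The upper corner `2 t^(y - ε)` of the box has valuation strictly below `x*`, hence cost of
  -- valuation strictly below that of `μ`.
  have hcz : ∑ j, c j * monomial 2 (y j - ε) ≤ μ := by
    refine (lt_of_val_lt hμ ?_).le
    have hnn : ∀ j ∈ Finset.univ, 0 ≤ c j * monomial 2 (y j - ε) := fun j _ =>
      mul_nonneg (hc j).le (monomial_pos two_pos _).le
    obtain ⟨r, hr⟩ := exists_val_eq hμ.ne'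
    rw [val_sum_of_nonneg _ _ hnn, Finset.sup_lt_iff (by rw [hr]; exact WithBot.bot_lt_coe r)]
    intro j _
    obtain ⟨γ, hγ⟩ := exists_val_eq (hc j).ne'
    have h1 := tropDot_le_iff.1 hxs.1.2 j
    rw [hγ, hr] at h1
    rw [val_mul, val_monomial two_ne_zero, hγ, hr]
    have h2 : γ + xs j ≤ r := by exact_mod_cast h1
    have h3 := (abs_lt.1 (hyx j)).2
    exact_mod_cast (by linarith : γ + (y j - ε) < r)
  have ec : ∀ᶠ t : ℝ in atTop, ∀ i, 0 < (c i).eval t := eventually_all.2 fun i =>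
    eventually_eval_pos (hc i)
  have eC : ∀ᶠ t : ℝ in atTop, C ≤ t ^ (δ - (2 * ε + n * (3 * ε))) :=
    (tendsto_rpow_atTop (sub_pos.2 hεδ)).eventually_ge_atTop C
  filter_upwards [eventually_polyhedronAt_subset_orthant hnonneg hzero,
    eventually_le_mul_one_add hnonneg hzero hc hμ hub hε,
    eventually_box_subset_polyhedronAt hnonneg hzero hy hε.le, eventually_eval_le hcz,
    eventually_eval_dot c (fun j => monomial 2 (y j - ε)), ec, eventually_eval_pos hμ, eC,
    eventually_ge_atTop 1] with t hK hup hbox hcz1 hcz2 hct hμt hCt ht1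
  have ht0 : 0 < t := by linarith
  have hwz : 2 * ((fun j => (c j).eval t / μ.eval t) ⬝ᵥ fun j => t ^ (y j - ε)) ≤ 1 := by
    rw [hcz2] at hcz1
    simp only [eval_monomial] at hcz1
    rw [← div_le_one hμt] at hcz1
    refine le_trans (le_of_eq ?_) hcz1
    rw [dotProduct, Finset.mul_sum, Finset.sum_div]
    exact Finset.sum_congr rfl fun j _ => by ring
  obtain ⟨hlo, hhi⟩ := hbounds (polyhedronAt A b t) (fun j => (c j).eval t / μ.eval t)
    (fun j => t ^ (xs j + ε)) (fun j => t ^ (y j - ε)) hK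
    (isClosed_polyhedronAt A b t).measurableSet (fun j => div_pos (hct j) hμt)
    (fun j => Real.rpow_pos_of_pos ht0 _) (fun j => Real.rpow_pos_of_pos ht0 _) hup hbox hwz i
  have hratio : ∀ j, t ^ (xs j + ε) / t ^ (y j - ε) ≤ t ^ (3 * ε) := fun j => by
    rw [← Real.rpow_sub ht0]
    refine Real.rpow_le_rpow_of_exponent_le ht1 ?_
    have := (abs_lt.1 (hyx j)).1
    linarith
  have hratio' : ∀ j, t ^ (-(3 * ε)) ≤ t ^ (y j - ε) / t ^ (xs j + ε) := fun j => by
    rw [← Real.rpow_sub ht0]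
    refine Real.rpow_le_rpow_of_exponent_le ht1 ?_
    have := (abs_lt.1 (hyx j)).1
    linarith
  have hpow : ∀ a : ℝ, ∏ _j : Fin n, t ^ a = t ^ (n * a) := fun a => by
    rw [Finset.prod_const, Finset.card_univ, Fintype.card_fin, ← Real.rpow_natCast,
      ← Real.rpow_mul ht0.le, mul_comm]
  have hprod : ∏ j, t ^ (xs j + ε) / t ^ (y j - ε) ≤ t ^ (n * (3 * ε)) :=
    (Finset.prod_le_prod (fun j _ => by positivity) fun j _ => hratio j).trans_eq (hpow _)
  have hprod' : t ^ (n * (-(3 * ε))) ≤ ∏ j, t ^ (y j - ε) / t ^ (xs j + ε) :=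
    (hpow _).symm.trans_le (Finset.prod_le_prod (fun j _ => by positivity) fun j _ => hratio' j)
  constructor
  · refine le_trans ?_ hlo
    have h1 : (t ^ (δ - (2 * ε + n * (3 * ε))))⁻¹ ≤ C⁻¹ := inv_anti₀ hC hCt
    rw [← Real.rpow_neg ht0.le] at h1
    have h2 : t ^ (xs i - 2 * ε) ≤ t ^ (y i - ε) := by
      refine Real.rpow_le_rpow_of_exponent_le ht1 ?_
      have := (abs_lt.1 (hyx i)).1
      linarith
    calc t ^ (xs i - δ) = t ^ (-(δ - (2 * ε + n * (3 * ε)))) *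
          (t ^ (xs i - 2 * ε) * t ^ (n * (-(3 * ε)))) := by
          rw [← Real.rpow_add ht0, ← Real.rpow_add ht0]
          congr 1
          ring
      _ ≤ _ := by gcongr
  · refine hhi.trans ?_
    calc C * (t ^ (xs i + ε) * ∏ j, t ^ (xs j + ε) / t ^ (y j - ε))
        ≤ t ^ (δ - (2 * ε + n * (3 * ε))) * (t ^ (xs i + ε) * t ^ (n * (3 * ε))) := by gcongr
      _ = t ^ (xs i + δ - ε) := by
          rw [← Real.rpow_add ht0, ← Real.rpow_add ht0]
          congr 1
          ring
      _ ≤ t ^ (xs i + δ) := Real.rpow_le_rpow_of_exponent_le ht1 (by linarith)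

end CentralPath

end TropicalEntropic

end

/-! ### Proof of the theorem -/

theorem theorem1 {m n : ℕ} (A : Matrix (Fin m) (Fin n) Puiseux) (b : Fin m → Puiseux)
    (c : Fin n → Puiseux)
    (hnonneg : ∀ x ∈ polyhedron A b, ∀ i, 0 ≤ x i)
    (hzero : (0 : Fin n → Puiseux) ∈ polyhedron A b)
    (hregular : valImage (polyhedron A b) = closure (interior (valImage (polyhedron A b))))
    (hc : ∀ i, 0 < c i)
    (μ : Puiseux) (hμ : 0 < μ) :
    IsTropicalPolytope
        {x ∈ valImage (polyhedron A b) | tropDot (fun i => (c i).val) x ≤ μ.val} ∧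
      (∀ᶠ t : ℝ in atTop, ∃! x : Fin n → ℝ,
        IsEntropicCentralPoint (polyhedronAt A b t) (fun i => (c i).eval t) (μ.eval t) x) ∧
      ∃ xstar : Fin n → ℝ,
        Tendsto
          (fun (t : ℝ) (i : Fin n) => Real.logb t
            (entropicCentralPath (polyhedronAt A b t) (fun i => (c i).eval t) (μ.eval t) i))
          atTop (𝓝 xstar) ∧
        IsTropicalBarycenter
          {x ∈ valImage (polyhedron A b) | tropDot (fun i => (c i).val) x ≤ μ.val}
          (fun i => (xstar i : Trop)) := by
  obtain ⟨xs, hxs⟩ := exists_real_isGreatest hnonneg hzero hregular hc hμ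
  obtain ⟨y, hy, -⟩ := exists_real_mem_interior_near (hregular ▸ hxs.1.1) one_pos
  have ec : ∀ᶠ t : ℝ in atTop, ∀ i, 0 < (c i).eval t := eventually_all.2 fun i =>
    Puiseux.eventually_eval_pos (hc i)
  have hev := (eventually_polyhedronAt_subset_orthant hnonneg hzero).and
    ((eventually_interior_nonempty hnonneg hzero hy).and
      (ec.and (Puiseux.eventually_eval_pos hμ)))
  refine ⟨⟨(isTropicalPolyhedron_valImage hnonneg hzero).inter
    (isTropicalPolyhedron_tropDot_le _ _),
    isCompact_section (hregular ▸ isClosed_closure) hc hμ⟩, ?_, xs, ?_, hxs⟩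
  · filter_upwards [hev] with t ⟨hK, hne, hct, hμt⟩
    have hiff := fun x => isEntropicCentralPoint_iff (x := x) (convex_polyhedronAt A b t) hK
      (isClosed_polyhedronAt A b t).measurableSet hne hct hμt
    exact ⟨_, (hiff _).2 rfl, fun x hx => (hiff x).1 hx⟩
  · refine tendsto_pi_nhds.2 fun i => tendsto_logb_of_rpow_bounds fun ε hε => ?_
    filter_upwards [hev,
      eventually_rpow_bounds_expMean hnonneg hzero hregular hc hμ hxs i hε]
      with t ⟨hK, hne, hct, hμt⟩ h
    rwa [entropicCentralPath_eq_expMean (convex_polyhedronAt A b t) hK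
      (isClosed_polyhedronAt A b t).measurableSet hne hct hμt]
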